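/- For $0<\tau<1$ let $(u_{0\tau},v_{0\tau})\in H^1(\mathbb R;\mathbb C)\times H^1(\mathbb R;\mathbb R)$ and let $u_0\in H^1(\mathbb R;\mathbb C)$ be such that (i) $\lim_{\tau\to0^+}\|u_{0\tau}-u_0\|_{H^1}=0$. Suppose further that at least one of the following holds: (ii) $\sup_{0<\tau<1}\|v_{0\tau}\|_{L^2}<\infty$; (iii) $\sup_{0<\tau<1}E_\tau(0)\le 0$ and there is $\gamma>0$ with $\|v_{0\tau}\|_{L^2}=O(\tau^{-1+\gamma})$ as $\tau\to0^+$, where $$E_\tau(0)=\int_{\mathbb R}\big(|\partial_x u_{0\tau}|^2+2v_{0\tau}|u_{0\tau}|^2+v_{0\tau}^2\big)\,dx .$$ Let $S(t)=e^{it\partial_x^2/2}$. For $0<\tau<1$ let $(u_\tau,v_\tau)\in C([0,\infty);H^1\times H^1)$ be the global solution, $v_\tau$ being real-valued, of the focusing Schrödinger–Debye system $$i\partial_tu_\tau+\tfrac12\partial_x^2u_\tau=u_\tau v_\tau,\qquad \tau\partial_tv_\tau+v_\tau=-|u_\tau|^2,\qquad (u_\tau,v_\tau)(0)=(u_{0\tau},v_{0\tau}),$$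 in the sense that for all $t\ge0$ $$u_\tau(t)=S(t)u_{0\tau}-i\int_0^tS(t-s)\,u_\tau(s)v_\tau(s)\,ds,\qquad v_\tau(t)=e^{-t/\tau}v_{0\tau}-\tfrac1\tau\int_0^te^{-(t-s)/\tau}|u_\tau(s)|^2\,ds .$$ Let $u$ be the global $L^2$-solution of the cubic nonlinear Schrödinger equation $i\partial_tu+\tfrac12\partial_x^2u=-|u|^2u$, $u(0)=u_0$; that is, $u\in C([0,\infty);L^2)$, $u\in L^4([0,T];L^\infty(\mathbb R))$ for every $T>0$ (so that $|u|^2u\in L^1([0,T];L^2)$), and $u(t)=S(t)u_0+i\int_0^tS(t-s)|u(s)|^2u(s)\,ds$ for all $t\ge0$. Then for every $T^*>0$ $$\lim_{\tau\to0^+}\ \sup_{0\le t\le T^*}\|u_\tau(t)-u(t)\|_{L^2}=0\qquad\text{and}\qquad \lim_{\tau\to0^+}\int_0^{T^*}\big\|v_\tau(t)+|u(t)|^2\big\|_{L^2}\,dt=0 .$$ -/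

import Mathlib

open MeasureTheory Filter Topology Set
open scoped FourierTransform SchwartzMap ENNReal

noncomputable section

namespace SchrodingerDebye

/-- The Lebesgue space `L²(ℝ; E)`. -/
abbrev L2 (E : Type*) [NormedAddCommGroup E] : Type _ :=
  Lp E 2 (volume : Measure ℝ)

/-- `g ∈ L²` is the weak (distributional) derivative of `f ∈ L²`. Since `f` and `g` lie in `L²`,
testing against Schwartz functions is the same as testing against compactly supported smooth
functions. -/
def IsWeakDeriv {E : Type*} [NormedAddCommGroup E] [NormedSpace ℝ E] (f g : L2 E) : Prop :=
  ∀ φ : 𝓢(ℝ, ℝ), ∫ x, deriv φ x • f x = - ∫ x, φ x • g x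

theorem integrable_schwartz_smul {E : Type*} [NormedAddCommGroup E] [NormedSpace ℝ E]
    (φ : 𝓢(ℝ, ℝ)) (f : L2 E) : Integrable (fun x => φ x • f x) := by
  have h := MemLp.smul (p := 2) (q := 2) (r := 1) (Lp.memLp f) (φ.memLp 2)
  exact memLp_one_iff_integrable.mp h

theorem integrable_deriv_schwartz_smul {E : Type*} [NormedAddCommGroup E] [NormedSpace ℝ E]
    (φ : 𝓢(ℝ, ℝ)) (f : L2 E) : Integrable (fun x => deriv φ x • f x) :=
  integrable_schwartz_smul (SchwartzMap.derivCLM ℝ ℝ φ) f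

/-- The space of pairs `(f, f')` in `L² × L²` such that `f'` is the weak derivative of `f`. -/
def h1Submodule (E : Type*) [NormedAddCommGroup E] [NormedSpace ℝ E] :
    Submodule ℝ (WithLp 2 (L2 E × L2 E)) where
  carrier := {p | IsWeakDeriv p.fst p.snd}
  zero_mem' := by
    intro φ
    have h : ((0 : L2 E) : ℝ → E) =ᵐ[volume] 0 := Lp.coeFn_zero E 2 volume
    have h1 : ∫ x, deriv φ x • (0 : L2 E) x = 0 := by
      apply integral_eq_zero_of_ae
      filter_upwards [h] with x hx
      rw [hx, Pi.zero_apply, smul_zero]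
    have h2 : ∫ x, φ x • (0 : L2 E) x = 0 := by
      apply integral_eq_zero_of_ae
      filter_upwards [h] with x hx
      rw [hx, Pi.zero_apply, smul_zero]
    change ∫ x, deriv φ x • (0 : L2 E) x = - ∫ x, φ x • (0 : L2 E) x
    rw [h1, h2, neg_zero]
  add_mem' := by
    intro p q hp hq φ
    change ∫ x, deriv φ x • (p.fst + q.fst) x = - ∫ x, φ x • (p.snd + q.snd) x
    have h1 : ∫ x, deriv φ x • (p.fst + q.fst) x
        = (∫ x, deriv φ x • p.fst x) + ∫ x, deriv φ x • q.fst x := by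
      rw [← integral_add (integrable_deriv_schwartz_smul φ _) (integrable_deriv_schwartz_smul φ _)]
      apply integral_congr_ae
      filter_upwards [Lp.coeFn_add p.fst q.fst] with x hx
      rw [hx, Pi.add_apply, smul_add]
    have h2 : ∫ x, φ x • (p.snd + q.snd) x
        = (∫ x, φ x • p.snd x) + ∫ x, φ x • q.snd x := by
      rw [← integral_add (integrable_schwartz_smul φ _) (integrable_schwartz_smul φ _)]
      apply integral_congr_ae
      filter_upwards [Lp.coeFn_add p.snd q.snd] with x hx
      rw [hx, Pi.add_apply, smul_add]
    rw [h1, h2, hp φ, hq φ, neg_add]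
  smul_mem' := by
    intro c p hp φ
    change ∫ x, deriv φ x • (c • p.fst) x = - ∫ x, φ x • (c • p.snd) x
    have h1 : ∫ x, deriv φ x • (c • p.fst) x = c • ∫ x, deriv φ x • p.fst x := by
      rw [← integral_smul]
      apply integral_congr_ae
      filter_upwards [Lp.coeFn_smul c p.fst] with x hx
      rw [hx, Pi.smul_apply, smul_comm]
    have h2 : ∫ x, φ x • (c • p.snd) x = c • ∫ x, φ x • p.snd x := by
      rw [← integral_smul]
      apply integral_congr_ae
      filter_upwards [Lp.coeFn_smul c p.snd] with x hx
      rw [hx, Pi.smul_apply, smul_comm]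
    rw [h1, h2, hp φ, smul_neg]

/-- The Sobolev space `H¹(ℝ; E)`, an element `f` being stored together with its (unique) weak
derivative `f'`. The inherited norm is `‖f‖_{H¹} = (‖f‖_{L²}² + ‖f'‖_{L²}²)^{1/2}`. -/
abbrev H1 (E : Type*) [NormedAddCommGroup E] [NormedSpace ℝ E] : Type _ :=
  h1Submodule E

/-- The `L²` function underlying an element of `H¹`. -/
def H1.fn {E : Type*} [NormedAddCommGroup E] [NormedSpace ℝ E] (f : H1 E) : L2 E :=
  f.1.fst

/-- The weak derivative of an element of `H¹`. -/
def H1.wderiv {E : Type*} [NormedAddCommGroup E] [NormedSpace ℝ E] (f : H1 E) : L2 E :=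
  f.1.snd

open Classical in
/-- The class in `L²` of a square integrable function (and `0` for any other function). -/
def toL2 {E : Type*} [NormedAddCommGroup E] (f : ℝ → E) : L2 E :=
  if h : MemLp f 2 (volume : Measure ℝ) then h.toLp f else 0

/-- The symbol `exp(-i t (2πξ)²/2)` of `exp(i t ∂ₓ²/2)`, for the Fourier transform
`𝓕 f ξ = ∫ f x exp(-2πi x ξ) dx`. -/
def phase (t ξ : ℝ) : ℂ :=
  Complex.exp (-(Complex.I * ((t * (2 * Real.pi * ξ) ^ 2 / 2 : ℝ) : ℂ)))

theorem norm_phase (t ξ : ℝ) : ‖phase t ξ‖ = 1 := by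
  unfold phase
  rw [Complex.norm_exp, Complex.neg_re, Complex.I_mul_re, Complex.ofReal_im, neg_zero, neg_zero,
    Real.exp_zero]

theorem memLp_phase_mul (t : ℝ) (f : L2 ℂ) :
    MemLp (fun ξ => phase t ξ * f ξ) 2 (volume : Measure ℝ) := by
  have hm : AEStronglyMeasurable (fun ξ => phase t ξ * f ξ) (volume : Measure ℝ) := by
    refine AEStronglyMeasurable.mul ?_ (Lp.aestronglyMeasurable f)
    refine Continuous.aestronglyMeasurable ?_
    unfold phase
    fun_prop
  refine (Lp.memLp f).of_le hm (Eventually.of_forall fun ξ => ?_)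
  rw [norm_mul, norm_phase, one_mul]

/-- The free Schrödinger group `S(t) = exp(i t ∂ₓ²/2)` on `L²(ℝ; ℂ)`. -/
def S (t : ℝ) (f : L2 ℂ) : L2 ℂ :=
  𝓕⁻ ((memLp_phase_mul t (𝓕 f)).toLp (fun ξ => phase t ξ * (𝓕 f) ξ))

/-- `(u, v) ∈ C([0,∞); H¹ × H¹)` is the global solution of the Schrödinger-Debye system
`i ∂ₜu + ½ ∂ₓ²u = u v`, `τ ∂ₜv + v = lam |u|²`, `u(0) = u₀`, `v(0) = v₀`, in Duhamel form, `v` being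
real-valued. (`H¹` is an algebra embedded in `L^∞`, so the products lie in `L²` and all integrands
are continuous in `s` with values in `L²`.) The values at negative times are irrelevant. -/
structure IsSDSolution (lam τ : ℝ) (u₀ : H1 ℂ) (v₀ : H1 ℝ) (u : ℝ → H1 ℂ) (v : ℝ → H1 ℝ) :
    Prop where
  continuousOn_u : ContinuousOn u (Ici 0)
  continuousOn_v : ContinuousOn v (Ici 0)
  duhamel_u : ∀ t : ℝ, 0 ≤ t →
    (u t).fn = S t u₀.fn
      - Complex.I • ∫ s in (0 : ℝ)..t, S (t - s) (toL2 fun x => (u s).fn x * ((v s).fn x : ℂ))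
  duhamel_v : ∀ t : ℝ, 0 ≤ t →
    (v t).fn = Real.exp (-t / τ) • v₀.fn
      + (lam / τ) • ∫ s in (0 : ℝ)..t,
          Real.exp (-(t - s) / τ) • toL2 fun x => ‖(u s).fn x‖ ^ 2

/-- `u` is the global `L²` solution of the cubic Schrödinger equation
`i ∂ₜu + ½ ∂ₓ²u = lam |u|² u`, `u(0) = u₀`, in Duhamel form: it lies in `C([0,∞); L²)` and in the
Strichartz space `L⁴([0,T]; L^∞)` for every `T` (the class in which the `L²` solution exists and is
unique). Hence `|u|² u ∈ L¹([0,T]; L²)`, so that the Bochner integral makes sense; this is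
recorded as a field. -/
structure IsNLSSolution (lam : ℝ) (u₀ : L2 ℂ) (u : ℝ → L2 ℂ) : Prop where
  continuousOn : ContinuousOn u (Ici 0)
  strichartz : ∀ T : ℝ, 0 < T → ∫⁻ t in Icc 0 T, eLpNorm (u t) ∞ volume ^ 4 < ∞
  integrable : ∀ T : ℝ, 0 < T →
    IntegrableOn (fun s => toL2 fun x => ((‖u s x‖ ^ 2 : ℝ) : ℂ) * u s x) (Icc 0 T)
  duhamel : ∀ t : ℝ, 0 ≤ t →
    u t = S t u₀
      - Complex.I • ∫ s in (0 : ℝ)..t,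
          S (t - s) ((lam : ℂ) • toL2 fun x => ((‖u s x‖ ^ 2 : ℝ) : ℂ) * u s x)

/-- The pseudo-Hamiltonian `E = ∫ (|∂ₓu|² + 2 v |u|² - lam v²) dx` of the Schrödinger-Debye system
(all three terms are integrable for `u ∈ H¹`, `v ∈ L²`). -/
def energy (lam : ℝ) (u : H1 ℂ) (v : H1 ℝ) : ℝ :=
  ∫ x, (‖u.wderiv x‖ ^ 2 + 2 * v.fn x * ‖u.fn x‖ ^ 2 - lam * v.fn x ^ 2)

end SchrodingerDebye

end

open SchrodingerDebye

/-!
The convergence is a perturbation argument around the limit `u`, and for `H¹` data it needs no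
Strichartz estimate and no conservation law: the dispersive estimate `‖S(t) f‖_∞ ≤ t^{-1/2} ‖f‖₁`
(`norm_inner_S_le_dispersive`) and the embedding `H¹ ⊂ L^∞`, uniform along the free flow
(`norm_inner_S_le_H1`), suffice.

The limit `u` is bounded on `[0, T] × ℝ` (`IsNLSSolution.exists_ae_norm_le`): in Duhamel's formula
`‖|u|²u‖₁ ≤ ‖u‖₂² ‖u‖_∞` is in `L⁴` in time, which pairs with the kernel `(t-s)^{-1/2}`. Therefore
`|u|²` is continuous in time with values in `L²`, and its average against the relaxation kernel
`τ⁻¹ e^{-(t-s)/τ}` is close to `|u(t)|²`, up to the initial layer `e^{-t/τ}`.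

Write `w = u_τ - u` and `q = v_τ + |u|²`. Then `u_τ v_τ + |u|²u = u_τ q - w |u|²`, and `q` is
controlled by the initial layer, the modulus of continuity of `|u|²` and the relaxation average of
`‖w‖₂` (`norm_fn_add_sq_le`). As long as `u_τ` is bounded by a fixed constant, a Gronwall argument
makes `w` small in `L²` (`norm_fn_sub_le`); the dispersive estimate then keeps `w` below `1/2` in
`L^∞` (`ae_norm_fn_sub_le`), so that the bound on `u_τ` improves itself and holds on all of `[0, T]`
(`ae_norm_fn_le_of_bootstrap`).

A bound for `v₀τ` in `L²` for small `τ` is what the argument starts from. Nonpositive energy gives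
one, because `‖v₀‖² ≤ -2 ∫ v₀ |u₀|²` (`norm_fn_le_of_energy_nonpos`).

Bounds in `L^∞` are stated as `∀ᵐ x, ‖f x‖ ≤ c`, and are obtained by testing against `L¹ ∩ L²`
(`ae_norm_le_of_forall_inner`), a form that passes through Bochner integrals in `L²`.
-/

namespace SchrodingerDebye

/-! ### The free group on the Fourier side -/

/-- A locally integrable function is determined by its pairings with Schwartz functions. -/
theorem ae_eq_of_forall_integral_schwartz_mul {f g : ℝ → ℂ} (hf : LocallyIntegrable f)
    (hg : LocallyIntegrable g)
    (h : ∀ φ : 𝓢(ℝ, ℂ), ∫ x, φ x * f x = ∫ x, φ x * g x) : f =ᵐ[volume] g := by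
  refine ae_eq_of_integral_contDiff_smul_eq hf hg fun χ hχ hc => ?_
  have hc' : HasCompactSupport (fun x => (χ x : ℂ)) := hc.comp_left Complex.ofReal_zero
  have hχ' : ContDiff ℝ ((⊤ : ℕ∞) : WithTop ℕ∞) (fun x => (χ x : ℂ)) := Complex.ofRealCLM.contDiff.comp hχ
  simpa using h (hc'.toSchwartzMap hχ')

theorem locallyIntegrable_L2 (f : L2 ℂ) : LocallyIntegrable f :=
  (Lp.memLp f).locallyIntegrable (by norm_num)

theorem integral_schwartz_mul_fourier (f : L2 ℂ) (φ : 𝓢(ℝ, ℂ)) :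
    ∫ x, φ x * (𝓕 f : L2 ℂ) x = ∫ x, (𝓕 φ) x * f x := by
  have h := congrArg (fun F => F φ) (Lp.fourier_toTemperedDistribution_eq f)
  simp only [TemperedDistribution.fourier_apply, Lp.toTemperedDistribution_apply,
    smul_eq_mul] at h
  exact h.symm

theorem integral_fourier_mul_eq {f g : ℝ → ℂ} (hf : Integrable f) (hg : Integrable g) :
    ∫ x, 𝓕 f x * g x = ∫ x, f x * 𝓕 g x := by
  have h := VectorFourier.integral_fourierIntegral_smul_eq_flip (L := innerₗ ℝ)
    Real.continuous_fourierChar continuous_inner hf hg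
  rw [flip_innerₗ] at h
  exact h

theorem continuous_fourier_of_integrable {f : ℝ → ℂ} (hf : Integrable f) : Continuous (𝓕 f) :=
  VectorFourier.fourierIntegral_continuous Real.continuous_fourierChar
    (innerSL ℝ).continuous₂ hf

theorem norm_fourier_le {f : ℝ → ℂ} (ξ : ℝ) : ‖𝓕 f ξ‖ ≤ ∫ x, ‖f x‖ :=
  VectorFourier.norm_fourierIntegral_le_integral_norm _ _ _ _ _

/-- On `L¹ ∩ L²` the Plancherel extension of the Fourier transform is given by the
Fourier integral. -/
theorem fourier_ae_eq (f : L2 ℂ) (hf : Integrable f) :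
    ((𝓕 f : L2 ℂ) : ℝ → ℂ) =ᵐ[volume] 𝓕 (f : ℝ → ℂ) := by
  refine ae_eq_of_forall_integral_schwartz_mul (locallyIntegrable_L2 _)
    (continuous_fourier_of_integrable hf).locallyIntegrable fun φ => ?_
  rw [integral_schwartz_mul_fourier, ← integral_fourier_mul_eq φ.integrable hf]
  rfl

theorem fourier_S (t : ℝ) (f : L2 ℂ) :
    𝓕 (S t f) = (memLp_phase_mul t (𝓕 f)).toLp (fun ξ => phase t ξ * (𝓕 f) ξ) :=
  FourierInvPair.fourier_fourierInv_eq _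

theorem fourier_S_ae (t : ℝ) (f : L2 ℂ) :
    ((𝓕 (S t f) : L2 ℂ) : ℝ → ℂ) =ᵐ[volume] fun ξ => phase t ξ * (𝓕 f : L2 ℂ) ξ := by
  rw [fourier_S]
  exact MemLp.coeFn_toLp _

theorem inner_S (t : ℝ) (g f : L2 ℂ) :
    inner ℂ g (S t f) = ∫ ξ, starRingEnd ℂ ((𝓕 g : L2 ℂ) ξ) * (phase t ξ * (𝓕 f : L2 ℂ) ξ) := by
  rw [← Lp.inner_fourier_eq, L2.inner_def]
  refine integral_congr_ae ?_
  filter_upwards [fourier_S_ae t f] with ξ h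
  rw [h, RCLike.inner_apply, mul_comm]

theorem norm_S (t : ℝ) (f : L2 ℂ) : ‖S t f‖ = ‖f‖ := by
  rw [← Lp.norm_fourier_eq (S t f), ← Lp.norm_fourier_eq f, Lp.norm_def, Lp.norm_def]
  congr 1
  refine eLpNorm_congr_norm_ae ?_
  filter_upwards [fourier_S_ae t f] with ξ h
  rw [h, norm_mul, norm_phase, one_mul]

theorem S_add (t : ℝ) (f g : L2 ℂ) : S t (f + g) = S t f + S t g := by
  apply (Lp.fourierTransformₗᵢ ℝ ℂ).injective
  change 𝓕 (S t (f + g)) = 𝓕 (S t f + S t g)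
  rw [FourierTransform.fourier_add]
  ext1
  have h := Lp.coeFn_add (𝓕 f : L2 ℂ) (𝓕 g)
  rw [← FourierTransform.fourier_add] at h
  filter_upwards [fourier_S_ae t (f + g), fourier_S_ae t f, fourier_S_ae t g, h,
    Lp.coeFn_add (𝓕 (S t f) : L2 ℂ) (𝓕 (S t g))] with ξ h1 h2 h3 h4 h5
  rw [h1, h5, Pi.add_apply, h2, h3, h4, Pi.add_apply, mul_add]

theorem S_smul (t : ℝ) (c : ℂ) (f : L2 ℂ) : S t (c • f) = c • S t f := by
  apply (Lp.fourierTransformₗᵢ ℝ ℂ).injective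
  change 𝓕 (S t (c • f)) = 𝓕 (c • S t f)
  rw [FourierTransform.fourier_smul]
  ext1
  have h := Lp.coeFn_smul c (𝓕 f : L2 ℂ)
  rw [← FourierTransform.fourier_smul] at h
  filter_upwards [fourier_S_ae t (c • f), fourier_S_ae t f, h,
    Lp.coeFn_smul c (𝓕 (S t f) : L2 ℂ)] with ξ h1 h2 h4 h5
  rw [h1, h5, Pi.smul_apply, h2, h4, Pi.smul_apply, smul_eq_mul, smul_eq_mul]
  ring

theorem S_sub (t : ℝ) (f g : L2 ℂ) : S t (f - g) = S t f - S t g := by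
  rw [sub_eq_add_neg, S_add, ← neg_one_smul ℂ g, S_smul, neg_one_smul, ← sub_eq_add_neg]

/-! ### Strong continuity and duality between `L¹` and `L^∞` -/

theorem continuous_phase (t : ℝ) : Continuous (phase t) := by
  unfold phase
  fun_prop

theorem continuous_inner_S (g f : L2 ℂ) : Continuous fun t => inner ℂ g (S t f) := by
  simp_rw [inner_S]
  have hi : Integrable fun ξ => ‖(𝓕 g : L2 ℂ) ξ‖ * ‖(𝓕 f : L2 ℂ) ξ‖ :=
    (Lp.memLp (𝓕 g : L2 ℂ)).norm.integrable_mul (Lp.memLp (𝓕 f : L2 ℂ)).norm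
  refine continuous_of_dominated (fun t => ?_) (fun t => ?_) hi ?_
  · exact (Complex.continuous_conj.comp_aestronglyMeasurable (Lp.aestronglyMeasurable _)).mul
      ((continuous_phase t).aestronglyMeasurable.mul (Lp.aestronglyMeasurable _))
  · refine Eventually.of_forall fun ξ => le_of_eq ?_
    rw [norm_mul, norm_mul, norm_phase, one_mul, RCLike.norm_conj]
  · refine Eventually.of_forall fun ξ => ?_
    unfold phase
    fun_prop

theorem continuous_S_left (f : L2 ℂ) : Continuous fun t => S t f := by
  -- weak continuity together with conservation of the norm gives strong continuity
  rw [continuous_iff_continuousAt]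
  intro t₀
  have h1 : Tendsto (fun t => 2 * ‖f‖ ^ 2 - 2 * RCLike.re (inner ℂ (S t₀ f) (S t f))) (𝓝 t₀)
      (𝓝 (2 * ‖f‖ ^ 2 - 2 * RCLike.re (inner ℂ (S t₀ f) (S t₀ f)))) :=
    ((RCLike.continuous_re.comp (continuous_inner_S (S t₀ f) f)).tendsto t₀).const_mul 2
      |>.const_sub _
  have h2 : ∀ t, ‖S t f - S t₀ f‖ ^ 2
      = 2 * ‖f‖ ^ 2 - 2 * RCLike.re (inner ℂ (S t₀ f) (S t f)) := fun t => by
    rw [norm_sub_rev, @norm_sub_sq ℂ, norm_S, norm_S]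
    ring
  have h3 : 2 * ‖f‖ ^ 2 - 2 * RCLike.re (inner ℂ (S t₀ f) (S t₀ f)) = 0 := by
    rw [← h2, sub_self, norm_zero, zero_pow two_ne_zero]
  rw [h3] at h1
  simp_rw [← h2] at h1
  have h4 := h1.sqrt
  simp_rw [Real.sqrt_sq (norm_nonneg _), Real.sqrt_zero] at h4
  exact tendsto_iff_norm_sub_tendsto_zero.mpr h4

theorem continuous_S : Continuous fun p : ℝ × L2 ℂ => S p.1 p.2 := by
  rw [continuous_iff_continuousAt]
  rintro ⟨t₀, f₀⟩
  refine tendsto_iff_norm_sub_tendsto_zero.mpr ?_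
  have h1 : Tendsto (fun p : ℝ × L2 ℂ => ‖p.2 - f₀‖ + ‖S p.1 f₀ - S t₀ f₀‖) (𝓝 (t₀, f₀))
      (𝓝 (‖f₀ - f₀‖ + ‖S t₀ f₀ - S t₀ f₀‖)) := by
    refine Continuous.tendsto (f := fun p : ℝ × L2 ℂ => ‖p.2 - f₀‖ + ‖S p.1 f₀ - S t₀ f₀‖) ?_ _
    have := (continuous_S_left f₀).comp (continuous_fst (X := ℝ) (Y := L2 ℂ))
    exact (continuous_snd.sub continuous_const).norm.add (this.sub continuous_const).norm
  simp only [sub_self, norm_zero, add_zero] at h1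
  refine squeeze_zero (fun _ => norm_nonneg _) (fun p => ?_) h1
  calc ‖S p.1 p.2 - S t₀ f₀‖ = ‖S p.1 (p.2 - f₀) + (S p.1 f₀ - S t₀ f₀)‖ := by
        rw [S_sub]; congr 1; abel
    _ ≤ _ := by
        refine (norm_add_le _ _).trans ?_
        rw [norm_S]

/-- Duality between `L¹` and `L^∞`, tested on `L¹ ∩ L²`. -/
theorem ae_norm_le_of_forall_inner (f : L2 ℂ) {c : ℝ} (hc : 0 ≤ c)
    (h : ∀ g : L2 ℂ, Integrable g → ‖inner ℂ g f‖ ≤ c * ∫ x, ‖g x‖) :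
    ∀ᵐ x, ‖f x‖ ≤ c := by
  have key : ∀ n : ℕ, volume ({x | c < ‖f x‖} ∩ Icc (-(n : ℝ)) n) = 0 := by
    intro n
    set A := {x | c < ‖f x‖} ∩ Icc (-(n : ℝ)) n with hA
    have hAm : MeasurableSet A :=
      ((Lp.stronglyMeasurable f).norm.measurable measurableSet_Ioi).inter measurableSet_Icc
    have hAf : volume A ≠ ∞ :=
      ((measure_mono inter_subset_right).trans_lt (by simp)).ne
    have hm : MemLp (A.indicator f) 2 := (Lp.memLp f).indicator hAm
    have hi : IntegrableOn f A := by
      have : IsFiniteMeasure (volume.restrict A) := ⟨by simpa using hAf.lt_top⟩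
      exact ((Lp.memLp f).restrict A).integrable (by norm_num)
    have hi2 : IntegrableOn (fun x => ‖f x‖ ^ 2) A := (Lp.memLp f).norm.integrable_sq.integrableOn
    set k : L2 ℂ := hm.toLp _ with hk
    have hg : (k : ℝ → ℂ) =ᵐ[volume] A.indicator f := hm.coeFn_toLp
    have h1 := h k ((integrable_congr hg).mpr (hi.integrable_indicator hAm))
    have h2 : inner ℂ k f = ((∫ x in A, ‖f x‖ ^ 2 : ℝ) : ℂ) := by
      rw [L2.inner_def, ← integral_indicator hAm, ← integral_complex_ofReal]
      refine integral_congr_ae ?_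
      filter_upwards [hg] with x hx
      rw [hx]
      by_cases hxA : x ∈ A
      · rw [indicator_of_mem hxA, indicator_of_mem hxA, inner_self_eq_norm_sq_to_K]
        simp
      · rw [indicator_of_notMem hxA, indicator_of_notMem hxA, inner_zero_left]
        simp
    have h3 : ∫ x, ‖k x‖ = ∫ x in A, ‖f x‖ := by
      rw [← integral_indicator hAm]
      refine integral_congr_ae ?_
      filter_upwards [hg] with x hx
      rw [hx, norm_indicator_eq_indicator_norm]
    rw [h2, h3, Complex.norm_real, Real.norm_eq_abs] at h1
    have h4 : ∫ x in A, (‖f x‖ ^ 2 - c * ‖f x‖) ≤ 0 := by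
      rw [integral_sub hi2 (hi.norm.const_mul c), integral_const_mul]
      linarith [le_abs_self (∫ x in A, ‖f x‖ ^ 2)]
    have hpos : ∀ x ∈ A, 0 < ‖f x‖ ^ 2 - c * ‖f x‖ := fun x hx => by
      have : c < ‖f x‖ := hx.1
      nlinarith
    have hnn : 0 ≤ᵐ[volume.restrict A] fun x => ‖f x‖ ^ 2 - c * ‖f x‖ :=
      (ae_restrict_iff' hAm).mpr (Eventually.of_forall fun x hx => (hpos x hx).le)
    have h5 := (setIntegral_eq_zero_iff_of_nonneg_ae hnn (hi2.sub (hi.norm.const_mul c))).mp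
      (le_antisymm h4 (integral_nonneg_of_ae hnn))
    have h6 : ∀ᵐ x ∂volume.restrict A, False := by
      filter_upwards [h5, ae_restrict_mem hAm] with x hx hxA
      exact (hpos x hxA).ne' hx
    simpa [ae_iff] using h6
  rw [ae_iff]
  refine measure_mono_null (fun x hx => ?_) (measure_iUnion_null key)
  obtain ⟨n, hn⟩ := exists_nat_ge |x|
  exact mem_iUnion.mpr ⟨n, not_le.mp hx, abs_le.mp hn⟩

theorem norm_inner_le_of_ae_norm_le {f g : L2 ℂ} {c : ℝ} (hf : ∀ᵐ x, ‖f x‖ ≤ c)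
    (hg : Integrable g) : ‖inner ℂ g f‖ ≤ c * ∫ x, ‖g x‖ := by
  rw [L2.inner_def, ← integral_const_mul]
  refine norm_integral_le_of_norm_le (hg.norm.const_mul c) ?_
  filter_upwards [hf] with x hx
  refine (norm_inner_le_norm _ _).trans ?_
  rw [mul_comm]
  gcongr

/-! ### The dispersive estimate -/

theorem norm_fourier_gaussian_mul_le {b : ℂ} (hb : 0 < b.re) (y x : ℝ) :
    ‖𝓕 (fun ξ : ℝ => Complex.exp (-b * ξ ^ 2) * Complex.exp (Complex.I * (-2 * Real.pi * y * ξ : ℝ))) x‖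
      ≤ ‖(Real.pi : ℂ) / b‖ ^ (1 / 2 : ℝ) := by
  have hb0 : b ≠ 0 := by
    rintro rfl
    simp at hb
  have h : 𝓕 (fun ξ : ℝ => Complex.exp (-b * ξ ^ 2)
      * Complex.exp (Complex.I * (-2 * Real.pi * y * ξ : ℝ))) x
      = (Real.pi / b) ^ (1 / 2 : ℂ) * Complex.exp (-((-2 * Real.pi * (x + y) : ℝ) : ℂ) ^ 2 / (4 * b)) := by
    rw [← fourierIntegral_gaussian hb, Real.fourier_real_eq_integral_exp_smul]
    refine integral_congr_ae (Eventually.of_forall fun ξ => ?_)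
    simp only [smul_eq_mul, ← Complex.exp_add]
    congr 1
    push_cast
    ring
  rw [h, norm_mul]
  have h1 : ‖((Real.pi : ℂ) / b) ^ (1 / 2 : ℂ)‖ = ‖(Real.pi : ℂ) / b‖ ^ (1 / 2 : ℝ) := by
    have := Complex.norm_cpow_real ((Real.pi : ℂ) / b) (1 / 2)
    push_cast at this
    exact this
  have h2 : ‖Complex.exp (-((-2 * Real.pi * (x + y) : ℝ) : ℂ) ^ 2 / (4 * b))‖ ≤ 1 := by
    rw [Complex.norm_exp, Real.exp_le_one_iff]
    have : -((-2 * Real.pi * (x + y) : ℝ) : ℂ) ^ 2 / (4 * b)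
        = ((-(-2 * Real.pi * (x + y)) ^ 2 / 4 : ℝ) : ℂ) * b⁻¹ := by
      push_cast
      field_simp
    rw [this, Complex.re_ofReal_mul, Complex.inv_re]
    have h3 : 0 ≤ b.re / Complex.normSq b := div_nonneg hb.le (Complex.normSq_nonneg _)
    nlinarith [sq_nonneg (-2 * Real.pi * (x + y))]
  rw [h1]
  exact mul_le_of_le_one_right (by positivity) h2

/-- The bilinear form of a Gaussian Fourier multiplier is bounded on `L¹ × L¹` by the sup norm of
its kernel. -/
theorem norm_integral_fourier_gaussian_le {b : ℂ} (hb : 0 < b.re) {f k : ℝ → ℂ}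
    (hf : Integrable f) (hk : Integrable k) :
    ‖∫ ξ, 𝓕 f ξ * (Complex.exp (-b * ξ ^ 2) * 𝓕 k ξ)‖
      ≤ ‖(Real.pi : ℂ) / b‖ ^ (1 / 2 : ℝ) * (∫ x, ‖k x‖) * ∫ x, ‖f x‖ := by
  have hG : Integrable fun ξ : ℝ => Complex.exp (-b * (ξ : ℂ) ^ 2) := integrable_cexp_neg_mul_sq hb
  have hGk : Integrable fun ξ : ℝ => Complex.exp (-b * (ξ : ℂ) ^ 2) * 𝓕 k ξ := by
    refine hG.mul_bdd (c := ∫ x, ‖k x‖)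
      (continuous_fourier_of_integrable hk).aestronglyMeasurable ?_
    exact Eventually.of_forall fun ξ => norm_fourier_le ξ
  rw [integral_fourier_mul_eq hf hGk, ← integral_const_mul]
  refine norm_integral_le_of_norm_le (hf.norm.const_mul _) (Eventually.of_forall fun y => ?_)
  rw [norm_mul, mul_comm]
  gcongr
  have hGe : Integrable fun ξ : ℝ => Complex.exp (-b * (ξ : ℂ) ^ 2)
      * Complex.exp (Complex.I * (-2 * Real.pi * y * ξ : ℝ)) := by
    refine hG.mul_bdd (c := 1) (Continuous.aestronglyMeasurable (by fun_prop)) ?_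
    refine Eventually.of_forall fun ξ => ?_
    rw [Complex.norm_exp, Complex.I_mul_re, Complex.ofReal_im, neg_zero, Real.exp_zero]
  have h : 𝓕 (fun ξ : ℝ => Complex.exp (-b * (ξ : ℂ) ^ 2) * 𝓕 k ξ) y
      = ∫ ξ, 𝓕 k ξ * (Complex.exp (-b * (ξ : ℂ) ^ 2)
          * Complex.exp (Complex.I * (-2 * Real.pi * y * ξ : ℝ))) := by
    rw [Real.fourier_real_eq_integral_exp_smul]
    refine integral_congr_ae (Eventually.of_forall fun ξ => ?_)
    simp only [smul_eq_mul]
    have : ((-2 * Real.pi * ξ * y : ℝ) : ℂ) * Complex.I = Complex.I * (-2 * Real.pi * y * ξ : ℝ) := by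
      push_cast
      ring
    rw [this]
    ring
  rw [h, integral_fourier_mul_eq hk hGe, ← integral_const_mul]
  refine norm_integral_le_of_norm_le (hk.norm.const_mul _) (Eventually.of_forall fun x => ?_)
  rw [norm_mul, mul_comm]
  gcongr
  exact norm_fourier_gaussian_mul_le hb y x

theorem conj_fourier (g : ℝ → ℂ) (ξ : ℝ) :
    starRingEnd ℂ (𝓕 g ξ) = 𝓕 (fun x => starRingEnd ℂ (g (-x))) ξ := by
  rw [Real.fourier_real_eq_integral_exp_smul, Real.fourier_real_eq_integral_exp_smul,
    ← integral_conj, ← integral_neg_eq_self]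
  refine integral_congr_ae (Eventually.of_forall fun x => ?_)
  simp only [smul_eq_mul, map_mul, ← Complex.exp_conj, Complex.conj_ofReal, Complex.conj_I]
  congr 2
  push_cast
  ring

/-- The dispersive estimate `‖S(t) f‖_∞ ≤ t^{-1/2} ‖f‖₁`, in dual form. -/
theorem norm_inner_S_le_dispersive {t : ℝ} (ht : 0 < t) {f g : L2 ℂ} (hf : Integrable f)
    (hg : Integrable g) :
    ‖inner ℂ g (S t f)‖ ≤ t ^ (-(1 / 2) : ℝ) * (∫ x, ‖f x‖) * ∫ x, ‖g x‖ := by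
  set k : ℝ → ℂ := fun x => starRingEnd ℂ (g (-x)) with hk
  have hki : Integrable k := Complex.conjCLE.toContinuousLinearMap.integrable_comp hg.comp_neg
  have hkn : ∫ x, ‖k x‖ = ∫ x, ‖g x‖ := by
    simp only [hk, RCLike.norm_conj]
    exact integral_neg_eq_self (fun x => ‖g x‖) volume
  -- the phase is approximated by Gaussians with parameter `ε + 2Real.pi²it`
  set b : ℝ → ℂ := fun ε => (ε : ℂ) + ((2 * Real.pi ^ 2 * t : ℝ) : ℂ) * Complex.I with hbdef
  have hbre : ∀ ε, (b ε).re = ε := fun ε => by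
    simp only [hbdef, Complex.add_re, Complex.ofReal_re, Complex.re_ofReal_mul, Complex.I_re,
      mul_zero, add_zero]
  have hbim : ∀ ε, (b ε).im = 2 * Real.pi ^ 2 * t := fun ε => by
    simp only [hbdef, Complex.add_im, Complex.ofReal_im, Complex.im_ofReal_mul, Complex.I_im,
      mul_one, zero_add]
  have hlim : Tendsto (fun ε => ∫ ξ, 𝓕 (f : ℝ → ℂ) ξ * (Complex.exp (-b ε * ξ ^ 2) * 𝓕 k ξ))
      (𝓝[>] 0) (𝓝 (inner ℂ g (S t f))) := by
    have hin : inner ℂ g (S t f)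
        = ∫ ξ, 𝓕 (f : ℝ → ℂ) ξ * (Complex.exp (-b 0 * ξ ^ 2) * 𝓕 k ξ) := by
      rw [inner_S]
      refine integral_congr_ae ?_
      filter_upwards [fourier_ae_eq f hf, fourier_ae_eq g hg] with ξ h1 h2
      rw [h1, h2, conj_fourier]
      have : phase t ξ = Complex.exp (-b 0 * ξ ^ 2) := by
        unfold phase
        congr 1
        simp only [hbdef]
        push_cast
        ring
      rw [this]
      ring
    rw [hin]
    have hfk : Integrable fun ξ => ‖𝓕 (f : ℝ → ℂ) ξ‖ * ‖𝓕 k ξ‖ := by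
      have h1 : Integrable fun ξ => ‖(𝓕 f : L2 ℂ) ξ‖ * ‖(𝓕 g : L2 ℂ) ξ‖ :=
        (Lp.memLp (𝓕 f : L2 ℂ)).norm.integrable_mul (Lp.memLp (𝓕 g : L2 ℂ)).norm
      refine h1.congr ?_
      filter_upwards [fourier_ae_eq f hf, fourier_ae_eq g hg] with ξ h1 h2
      rw [h1, h2, ← conj_fourier, RCLike.norm_conj]
    refine tendsto_integral_filter_of_dominated_convergence _ ?_ ?_ hfk ?_
    · refine Eventually.of_forall fun ε => Continuous.aestronglyMeasurable ?_
      exact (continuous_fourier_of_integrable hf).mul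
        (Continuous.mul (by fun_prop) (continuous_fourier_of_integrable hki))
    · filter_upwards [self_mem_nhdsWithin] with ε hε
      refine Eventually.of_forall fun ξ => ?_
      rw [norm_mul, norm_mul]
      gcongr
      refine mul_le_of_le_one_left (norm_nonneg _) ?_
      rw [Complex.norm_exp, Real.exp_le_one_iff]
      have : (-b ε * (ξ : ℂ) ^ 2).re = - ε * ξ ^ 2 := by
        rw [← Complex.ofReal_pow, Complex.re_mul_ofReal, Complex.neg_re, hbre]
      rw [this]
      have : (0 : ℝ) < ε := hε
      nlinarith [sq_nonneg ξ]
    · refine Eventually.of_forall fun ξ => ?_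
      have hc : Continuous fun ε =>
          𝓕 (f : ℝ → ℂ) ξ * (Complex.exp (-b ε * ξ ^ 2) * 𝓕 k ξ) := by
        simp only [hbdef]
        fun_prop
      exact (hc.tendsto 0).mono_left nhdsWithin_le_nhds
  refine le_of_tendsto hlim.norm ?_
  filter_upwards [self_mem_nhdsWithin] with ε hε
  have h1 := norm_integral_fourier_gaussian_le (b := b ε) (by rw [hbre]; exact hε) hf hki
  rw [hkn] at h1
  refine h1.trans ?_
  have h2 : ‖(Real.pi : ℂ) / b ε‖ ^ (1 / 2 : ℝ) ≤ t ^ (-(1 / 2) : ℝ) := by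
    rw [Real.rpow_neg ht.le, ← Real.inv_rpow ht.le]
    refine Real.rpow_le_rpow (norm_nonneg _) ?_ (by norm_num)
    have h3 : 2 * Real.pi ^ 2 * t ≤ ‖b ε‖ := by
      rw [← hbim ε]
      exact (le_abs_self _).trans (Complex.abs_im_le_norm _)
    have hpi : 1 ≤ Real.pi := by linarith [Real.pi_gt_three]
    have hpi0 : 0 < 2 * Real.pi ^ 2 * t := by positivity
    rw [norm_div, Complex.norm_real, Real.norm_eq_abs, abs_of_pos Real.pi_pos,
      div_le_iff₀ (hpi0.trans_le h3)]
    calc Real.pi ≤ t⁻¹ * (2 * Real.pi ^ 2 * t) := by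
          field_simp
          nlinarith
      _ ≤ _ := by gcongr
  calc _ = ‖(Real.pi : ℂ) / b ε‖ ^ (1 / 2 : ℝ) * ((∫ x, ‖f x‖) * ∫ x, ‖g x‖) := by ring
    _ ≤ t ^ (-(1 / 2) : ℝ) * ((∫ x, ‖f x‖) * ∫ x, ‖g x‖) := by
        gcongr
    _ = _ := by ring

/-! ### The Sobolev space `H¹` and the embedding into `L^∞` -/

section H1

variable {E : Type*} [NormedAddCommGroup E]

theorem L2.integrable_norm_sq (f : L2 E) : Integrable fun x => ‖f x‖ ^ 2 :=
  (Lp.memLp f).norm.integrable_sq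

theorem L2.norm_sq_eq_integral (f : L2 E) : ‖f‖ ^ 2 = ∫ x, ‖f x‖ ^ 2 := by
  have h := (Lp.memLp f).eLpNorm_eq_integral_rpow_norm (by norm_num) (by norm_num)
  rw [Lp.norm_def, h, ENNReal.toReal_ofReal (by positivity)]
  simp only [ENNReal.toReal_ofNat, Real.rpow_two]
  rw [← Real.rpow_two, ← Real.rpow_mul (integral_nonneg fun x => by positivity)]
  norm_num

variable [NormedSpace ℝ E]

theorem H1.norm_sq (f : H1 E) : ‖f‖ ^ 2 = ‖f.fn‖ ^ 2 + ‖f.wderiv‖ ^ 2 :=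
  WithLp.prod_norm_sq_eq_of_L2 _

theorem H1.norm_fn_le (f : H1 E) : ‖f.fn‖ ≤ ‖f‖ := by
  refine abs_le_of_sq_le_sq' ?_ (norm_nonneg _) |>.2
  rw [f.norm_sq]
  linarith [sq_nonneg ‖f.wderiv‖]

theorem H1.fn_sub (f g : H1 E) : (f - g).fn = f.fn - g.fn := rfl

theorem H1.continuous_fn : Continuous (H1.fn : H1 E → L2 E) :=
  (WithLp.continuous_fst 2 _ _).comp continuous_subtype_val

theorem H1.isWeakDeriv (f : H1 E) : IsWeakDeriv f.fn f.wderiv := f.2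

end H1

/-- The defining identity of the weak derivative extends to complex-valued test functions. -/
theorem integral_deriv_mul_fn (f : H1 ℂ) (φ : 𝓢(ℝ, ℂ)) :
    ∫ x, deriv φ x * f.fn x = -∫ x, φ x * f.wderiv x := by
  set a : 𝓢(ℝ, ℝ) := SchwartzMap.postcompCLM (𝕜 := ℝ) Complex.reCLM φ with ha
  set b : 𝓢(ℝ, ℝ) := SchwartzMap.postcompCLM (𝕜 := ℝ) Complex.imCLM φ with hb
  have hφ : ∀ x, φ x = a x + b x * Complex.I := fun x => (Complex.re_add_im _).symm
  have hd : ∀ x, deriv φ x = deriv a x + deriv b x * Complex.I := fun x => by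
    have h1 : deriv a x = (deriv φ x).re :=
      ((Complex.reCLM.hasFDerivAt (x := φ x)).comp_hasDerivAt x (φ.hasDerivAt x)).deriv
    have h2 : deriv b x = (deriv φ x).im :=
      ((Complex.imCLM.hasFDerivAt (x := φ x)).comp_hasDerivAt x (φ.hasDerivAt x)).deriv
    rw [h1, h2, Complex.re_add_im]
  have hia := f.isWeakDeriv a
  have hib := f.isWeakDeriv b
  simp only [Complex.real_smul] at hia hib
  have i1 := integrable_deriv_schwartz_smul a f.fn
  have i2 := integrable_deriv_schwartz_smul b f.fn
  have i3 := integrable_schwartz_smul a f.wderiv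
  have i4 := integrable_schwartz_smul b f.wderiv
  simp only [Complex.real_smul] at i1 i2 i3 i4
  calc ∫ x, deriv φ x * f.fn x
      = ∫ x, (deriv a x * f.fn x + Complex.I * (deriv b x * f.fn x)) := by
        refine integral_congr_ae (Eventually.of_forall fun x => ?_)
        simp only [hd]
        ring
    _ = -∫ x, (a x * f.wderiv x + Complex.I * (b x * f.wderiv x)) := by
        rw [integral_add i1 (i2.const_mul _), integral_add i3 (i4.const_mul _),
          integral_const_mul, integral_const_mul, hia, hib]
        ring
    _ = _ := by
        congr 1
        refine integral_congr_ae (Eventually.of_forall fun x => ?_)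
        simp only [hφ]
        ring

theorem fourier_wderiv_ae (f : H1 ℂ) :
    ((𝓕 f.wderiv : L2 ℂ) : ℝ → ℂ) =ᵐ[volume]
      fun ξ => 2 * Real.pi * Complex.I * ξ * (𝓕 f.fn : L2 ℂ) ξ := by
  have hloc : LocallyIntegrable fun ξ : ℝ => 2 * Real.pi * Complex.I * ξ * (𝓕 f.fn : L2 ℂ) ξ := by
    have h := (locallyIntegrable_L2 (𝓕 f.fn : L2 ℂ))
    have hc : Continuous fun ξ : ℝ => 2 * Real.pi * Complex.I * ξ := by fun_prop
    simpa only [smul_eq_mul] using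
      (locallyIntegrableOn_univ.mp ((locallyIntegrableOn_univ.mpr h).continuousOn_smul
        isOpen_univ.isLocallyClosed hc.continuousOn))
  refine ae_eq_of_forall_integral_schwartz_mul (locallyIntegrable_L2 _) hloc fun φ => ?_
  have hg : (fun ξ : ℝ => -(2 * Real.pi * Complex.I * ξ)).HasTemperateGrowth := by fun_prop
  set ψ : 𝓢(ℝ, ℂ) := SchwartzMap.smulLeftCLM ℂ (fun ξ : ℝ => -(2 * Real.pi * Complex.I * ξ)) φ
    with hψ
  have hψa : ∀ ξ, ψ ξ = -(2 * Real.pi * Complex.I * ξ) * φ ξ := fun ξ => by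
    rw [hψ, SchwartzMap.smulLeftCLM_apply_apply hg, smul_eq_mul]
  have hder : ∀ x, deriv (𝓕 φ : 𝓢(ℝ, ℂ)) x = (𝓕 ψ : 𝓢(ℝ, ℂ)) x := fun x => by
    have h1 : Integrable fun x : ℝ => x • φ x := by
      have hg' : (fun ξ : ℝ => ξ).HasTemperateGrowth := by fun_prop
      refine (SchwartzMap.smulLeftCLM ℂ (fun ξ : ℝ => ξ) φ).integrable.congr ?_
      exact Eventually.of_forall fun ξ => SchwartzMap.smulLeftCLM_apply_apply hg' _ _
    have h := congrFun (Real.deriv_fourier φ.integrable h1) x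
    refine h.trans ?_
    have h2 : (fun ξ : ℝ => (-2 * Real.pi * Complex.I * ξ) • φ ξ) = ψ := by
      funext ξ
      rw [hψa, smul_eq_mul]
      ring
    rw [h2]
    rfl
  rw [integral_schwartz_mul_fourier, ← neg_eq_iff_eq_neg.mpr (integral_deriv_mul_fn f (𝓕 φ))]
  simp_rw [hder]
  rw [← integral_schwartz_mul_fourier, ← integral_neg]
  refine integral_congr_ae (Eventually.of_forall fun ξ => ?_)
  simp only [hψa]
  ring

/-- The Sobolev embedding `H¹ ⊂ L^∞` along the free flow, in dual form. -/
theorem norm_inner_S_le_H1 (t : ℝ) (f : H1 ℂ) {g : L2 ℂ} (hg : Integrable g) :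
    ‖inner ℂ g (S t f.fn)‖ ≤ 3 * ‖f‖ * ∫ x, ‖g x‖ := by
  set G := ∫ x, ‖g x‖ with hG
  have hG0 : 0 ≤ G := integral_nonneg fun _ => norm_nonneg _
  set F : L2 ℂ := 𝓕 f.fn with hF
  set F' : L2 ℂ := 𝓕 f.wderiv with hF'
  have hN : ‖f‖ ^ 2 = (∫ ξ, ‖F ξ‖ ^ 2) + ∫ ξ, ‖F' ξ‖ ^ 2 := by
    rw [f.norm_sq, ← L2.norm_sq_eq_integral, ← L2.norm_sq_eq_integral, hF, hF',
      Lp.norm_fourier_eq, Lp.norm_fourier_eq]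
  have key : ∀ K, ‖f‖ < K → ‖inner ℂ g (S t f.fn)‖ ≤ 3 * K * G := by
    intro K hK
    have hK0 : 0 < K := (norm_nonneg _).trans_lt hK
    have hsum : Integrable fun ξ => ‖F ξ‖ ^ 2 + ‖F' ξ‖ ^ 2 :=
      (L2.integrable_norm_sq F).add (L2.integrable_norm_sq F')
    have hint : Integrable fun ξ : ℝ =>
        G * (K / 2 * (1 + ξ ^ 2)⁻¹ + (2 * K)⁻¹ * (‖F ξ‖ ^ 2 + ‖F' ξ‖ ^ 2)) :=
      ((integrable_inv_one_add_sq.const_mul _).add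
        (hsum.const_mul _)).const_mul _
    have hval : ∫ ξ : ℝ, G * (K / 2 * (1 + ξ ^ 2)⁻¹ + (2 * K)⁻¹ * (‖F ξ‖ ^ 2 + ‖F' ξ‖ ^ 2))
        = G * (K / 2 * Real.pi + (2 * K)⁻¹ * ‖f‖ ^ 2) := by
      rw [integral_const_mul, integral_add (integrable_inv_one_add_sq.const_mul _)
        (hsum.const_mul _),
        integral_const_mul, integral_const_mul,
        integral_add (L2.integrable_norm_sq F) (L2.integrable_norm_sq F'), ← hN,
        integral_univ_inv_one_add_sq]
    have hle : ‖inner ℂ g (S t f.fn)‖ ≤ G * (K / 2 * Real.pi + (2 * K)⁻¹ * ‖f‖ ^ 2) := by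
      rw [← hval, inner_S]
      refine norm_integral_le_of_norm_le hint ?_
      filter_upwards [fourier_ae_eq g hg, fourier_wderiv_ae f] with ξ h1 h2
      rw [norm_mul, norm_mul, norm_phase, one_mul, RCLike.norm_conj, h1]
      refine mul_le_mul (norm_fourier_le ξ) ?_ (norm_nonneg _) hG0
      have h3 : ξ ^ 2 * ‖F ξ‖ ^ 2 ≤ ‖F' ξ‖ ^ 2 := by
        rw [hF', h2]
        simp only [norm_mul, Complex.norm_real, Complex.norm_I, mul_pow, Real.norm_eq_abs, sq_abs]
        have : (1 : ℝ) ≤ ‖(2 : ℂ)‖ ^ 2 * Real.pi ^ 2 * 1 ^ 2 := by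
          rw [Complex.norm_ofNat]
          nlinarith [Real.pi_gt_three]
        calc ξ ^ 2 * ‖F ξ‖ ^ 2 = 1 * (ξ ^ 2 * ‖F ξ‖ ^ 2) := (one_mul _).symm
          _ ≤ (‖(2 : ℂ)‖ ^ 2 * Real.pi ^ 2 * 1 ^ 2) * (ξ ^ 2 * ‖F ξ‖ ^ 2) := by gcongr
          _ = _ := by ring
      have hx : 0 < 1 + ξ ^ 2 := by positivity
      -- Young's inequality `|F| ≤ K / (2(1+ξ²)) + (1+ξ²)|F|² / (2K)`
      calc ‖F ξ‖ ≤ K / 2 * (1 + ξ ^ 2)⁻¹ + (2 * K)⁻¹ * ((1 + ξ ^ 2) * ‖F ξ‖ ^ 2) := by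
            have h4 : 0 ≤ (K - (1 + ξ ^ 2) * ‖F ξ‖) ^ 2 / (2 * K * (1 + ξ ^ 2)) := by positivity
            have h5 : (K - (1 + ξ ^ 2) * ‖F ξ‖) ^ 2 / (2 * K * (1 + ξ ^ 2))
                = K / 2 * (1 + ξ ^ 2)⁻¹ + (2 * K)⁻¹ * ((1 + ξ ^ 2) * ‖F ξ‖ ^ 2) - ‖F ξ‖ := by
              field_simp
              ring
            linarith
        _ ≤ _ := by
            gcongr
            linarith
    refine hle.trans ?_
    rw [mul_comm]
    gcongr
    have h6 : (2 * K)⁻¹ * ‖f‖ ^ 2 ≤ K / 2 := by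
      have : ‖f‖ ^ 2 ≤ K ^ 2 := by gcongr
      rw [inv_mul_le_iff₀ (by positivity)]
      nlinarith
    nlinarith [Real.pi_lt_four]
  have hlim : Tendsto (fun K => 3 * K * G) (𝓝[>] ‖f‖) (𝓝 (3 * ‖f‖ * G)) := by
    have hc : Continuous fun K => 3 * K * G := by fun_prop
    exact (hc.tendsto _).mono_left nhdsWithin_le_nhds
  refine ge_of_tendsto hlim ?_
  filter_upwards [self_mem_nhdsWithin] with K hK using key K hK

theorem S_zero (f : L2 ℂ) : S 0 f = f := by
  apply (Lp.fourierTransformₗᵢ ℝ ℂ).injective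
  change 𝓕 (S 0 f) = 𝓕 f
  ext1
  filter_upwards [fourier_S_ae 0 f] with ξ h
  rw [h]
  simp [phase]

theorem ae_norm_S_fn_le (t : ℝ) (f : H1 ℂ) : ∀ᵐ x, ‖S t f.fn x‖ ≤ 3 * ‖f‖ :=
  ae_norm_le_of_forall_inner _ (by positivity) fun _ hg => norm_inner_S_le_H1 t f hg

/-- The Sobolev embedding `H¹(ℝ) ⊂ L^∞(ℝ)`. -/
theorem H1.ae_norm_fn_le (f : H1 ℂ) : ∀ᵐ x, ‖f.fn x‖ ≤ 3 * ‖f‖ := by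
  have h := ae_norm_S_fn_le 0 f
  rwa [S_zero] at h

/-! ### Kernels in time -/

theorem intervalIntegrable_sub_rpow (t : ℝ) :
    IntervalIntegrable (fun s => (t - s) ^ (-(3 / 4) : ℝ)) volume 0 t := by
  have h := (intervalIntegral.intervalIntegrable_rpow' (a := 0) (b := t)
    (r := -(3 / 4)) (by norm_num)).comp_sub_left t
  simpa using h.symm

theorem integral_sub_rpow (t : ℝ) :
    ∫ s in (0 : ℝ)..t, (t - s) ^ (-(3 / 4) : ℝ) = 4 * t ^ (1 / 4 : ℝ) := by
  rw [intervalIntegral.integral_comp_sub_left (fun s => s ^ (-(3 / 4) : ℝ)), sub_self, sub_zero,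
    integral_rpow (Or.inl (by norm_num))]
  norm_num
  ring

/-- A pointwise Young inequality. Integrated in `d`, it replaces Hölder's inequality against the
singular kernel `d^{-1/2}` of the dispersive estimate. -/
theorem rpow_mul_le_young {d y κ : ℝ} (hd : 0 < d) (hy : 0 ≤ y) (hκ : 0 < κ) :
    d ^ (-(1 / 2) : ℝ) * y ≤ κ * d ^ (-(3 / 4) : ℝ) + (κ ^ 2)⁻¹ * y ^ 3 := by
  set p := d ^ (-(1 / 4) : ℝ) with hp
  have hp0 : 0 < p := Real.rpow_pos_of_pos hd _
  have h2 : d ^ (-(1 / 2) : ℝ) = p ^ 2 := by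
    rw [hp, ← Real.rpow_natCast, ← Real.rpow_mul hd.le]; norm_num
  have h3 : d ^ (-(3 / 4) : ℝ) = p ^ 3 := by
    rw [hp, ← Real.rpow_natCast, ← Real.rpow_mul hd.le]; norm_num
  rw [h2, h3]
  rcases le_total y (κ * p) with h | h
  · calc p ^ 2 * y ≤ p ^ 2 * (κ * p) := by gcongr
      _ = κ * p ^ 3 := by ring
      _ ≤ _ := le_add_of_nonneg_right (by positivity)
  · have h4 : p ≤ κ⁻¹ * y := by
      rw [inv_mul_eq_div, le_div_iff₀ hκ, mul_comm]; exact h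
    calc p ^ 2 * y ≤ (κ⁻¹ * y) ^ 2 * y := by gcongr
      _ = (κ ^ 2)⁻¹ * y ^ 3 := by rw [mul_pow, inv_pow]; ring
      _ ≤ _ := le_add_of_nonneg_left (by positivity)

theorem hasDerivAt_exp_relax (t τ s : ℝ) :
    HasDerivAt (fun s => Real.exp (-(t - s) / τ)) (Real.exp (-(t - s) / τ) * (1 / τ)) s := by
  have h : HasDerivAt (fun s => -(t - s) / τ) (1 / τ) s := by
    have := ((hasDerivAt_id s).const_sub t).neg.div_const τ
    simpa using this
  exact h.exp

/-- The relaxation kernel has mass `1 - exp(-t/τ)` on `[0, t]`. -/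
theorem integral_exp_relax {τ : ℝ} (hτ : 0 < τ) (t : ℝ) :
    ∫ s in (0 : ℝ)..t, Real.exp (-(t - s) / τ) = τ * (1 - Real.exp (-t / τ)) := by
  have h := intervalIntegral.integral_eq_sub_of_hasDerivAt (a := 0) (b := t)
    (fun s _ => (hasDerivAt_exp_relax t τ s).const_mul τ)
    (Continuous.intervalIntegrable (by fun_prop) _ _)
  have e : ∀ s, τ * (Real.exp (-(t - s) / τ) * (1 / τ)) = Real.exp (-(t - s) / τ) := fun s => by
    field_simp
  simp only [e] at h
  rw [h]
  simp
  ring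

theorem integral_exp_neg_div {τ : ℝ} (hτ : 0 < τ) (t : ℝ) :
    ∫ s in (0 : ℝ)..t, Real.exp (-s / τ) = τ * (1 - Real.exp (-t / τ)) := by
  rw [← integral_exp_relax hτ,
    intervalIntegral.integral_comp_sub_left (fun s => Real.exp (-s / τ)), sub_self, sub_zero]

theorem integral_exp_neg_div_le {τ : ℝ} (hτ : 0 < τ) (t : ℝ) :
    ∫ s in (0 : ℝ)..t, Real.exp (-s / τ) ≤ τ := by
  rw [integral_exp_neg_div hτ]
  nlinarith [Real.exp_pos (-t / τ)]

theorem integral_exp_relax_mul_le {τ t : ℝ} (hτ : 0 < τ) (ht : 0 ≤ t) :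
    ∫ s in (0 : ℝ)..t, Real.exp (-(t - s) / τ) * (t - s) ≤ τ ^ 2 := by
  have h := intervalIntegral.integral_eq_sub_of_hasDerivAt (a := 0) (b := t)
    (f := fun s => τ * (Real.exp (-(t - s) / τ) * (t - s + τ)))
    (f' := fun s => Real.exp (-(t - s) / τ) * (t - s))
    (fun s _ => by
      have h1 := ((hasDerivAt_exp_relax t τ s).mul
        (((hasDerivAt_id s).const_sub t).add_const τ)).const_mul τ
      refine h1.congr_deriv ?_
      field_simp
      simp)
    (Continuous.intervalIntegrable (by fun_prop) _ _)
  rw [h]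
  have h2 : 0 ≤ τ * (Real.exp (-(t - 0) / τ) * (t - 0 + τ)) := by
    have : 0 ≤ t - 0 + τ := by linarith
    positivity
  have h3 : τ * (Real.exp (-(t - t) / τ) * (t - t + τ)) = τ ^ 2 := by
    simp
    ring
  linarith

/-! ### The relaxation operator -/

/-- The relaxation operator `x₀ ↦ exp(-t/τ) x₀ - τ⁻¹ ∫ exp(-(t-s)/τ) g(s) ds` is close to `-y` as
soon as `g` is close to `y` near time `t`. -/
theorem norm_relax_add_le {X : Type*} [NormedAddCommGroup X] [NormedSpace ℝ X] [CompleteSpace X]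
    {τ t c Λ : ℝ} (hτ : 0 < τ) (ht : 0 ≤ t) (hc : 0 ≤ c) (hΛ : 0 ≤ Λ) (x₀ y : X) {g : ℝ → X}
    (hg : ContinuousOn g (Icc 0 t)) (hgy : ∀ s ∈ Icc 0 t, ‖y - g s‖ ≤ c + Λ * (t - s)) :
    ‖Real.exp (-t / τ) • x₀ + (-1 / τ) • (∫ s in (0 : ℝ)..t, Real.exp (-(t - s) / τ) • g s) + y‖
      ≤ Real.exp (-t / τ) * ‖x₀ + y‖ + (c + Λ * τ) := by
  have hgi : IntervalIntegrable (fun s => Real.exp (-(t - s) / τ) • g s) volume 0 t := by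
    refine ContinuousOn.intervalIntegrable ?_
    rw [uIcc_of_le ht]
    exact ContinuousOn.smul (Continuous.continuousOn (by fun_prop)) hg
  have hyi : IntervalIntegrable (fun s => Real.exp (-(t - s) / τ) • y) volume 0 t :=
    Continuous.intervalIntegrable (by fun_prop) _ _
  have hsplit : Real.exp (-t / τ) • x₀
      + (-1 / τ) • (∫ s in (0 : ℝ)..t, Real.exp (-(t - s) / τ) • g s) + y
      = Real.exp (-t / τ) • (x₀ + y)
        + (1 / τ) • ∫ s in (0 : ℝ)..t, Real.exp (-(t - s) / τ) • (y - g s) := by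
    have h1 : ∫ s in (0 : ℝ)..t, Real.exp (-(t - s) / τ) • (y - g s)
        = (τ * (1 - Real.exp (-t / τ))) • y - ∫ s in (0 : ℝ)..t, Real.exp (-(t - s) / τ) • g s := by
      simp_rw [smul_sub]
      rw [intervalIntegral.integral_sub hyi hgi, intervalIntegral.integral_smul_const,
        integral_exp_relax hτ]
    rw [h1, smul_sub, smul_smul, ← mul_assoc, one_div_mul_cancel hτ.ne', one_mul,
      neg_div τ 1, neg_smul, smul_add, sub_smul, one_smul]
    abel
  rw [hsplit]
  refine (norm_add_le _ _).trans ?_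
  rw [norm_smul, Real.norm_of_nonneg (Real.exp_pos _).le]
  gcongr
  rw [norm_smul, Real.norm_of_nonneg (by positivity : 0 ≤ 1 / τ), one_div, inv_mul_le_iff₀ hτ]
  have hbi : ∀ k : ℝ → ℝ, Continuous k →
      IntervalIntegrable (fun s => Real.exp (-(t - s) / τ) * k s) volume 0 t := fun k hk =>
    Continuous.intervalIntegrable (by fun_prop) _ _
  calc ‖∫ s in (0 : ℝ)..t, Real.exp (-(t - s) / τ) • (y - g s)‖
      ≤ ∫ s in (0 : ℝ)..t, Real.exp (-(t - s) / τ) * (c + Λ * (t - s)) := by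
        refine intervalIntegral.norm_integral_le_of_norm_le ht ?_ (hbi _ (by fun_prop))
        refine Eventually.of_forall fun s hs => ?_
        rw [norm_smul, Real.norm_of_nonneg (Real.exp_pos _).le]
        gcongr
        exact hgy s ⟨hs.1.le, hs.2⟩
    _ = c * (∫ s in (0 : ℝ)..t, Real.exp (-(t - s) / τ))
        + Λ * ∫ s in (0 : ℝ)..t, Real.exp (-(t - s) / τ) * (t - s) := by
        rw [← intervalIntegral.integral_const_mul, ← intervalIntegral.integral_const_mul,
          ← intervalIntegral.integral_add]
        · refine intervalIntegral.integral_congr fun s _ => ?_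
          ring
        · exact Continuous.intervalIntegrable (by fun_prop) _ _
        · exact Continuous.intervalIntegrable (by fun_prop) _ _
    _ ≤ c * τ + Λ * τ ^ 2 := by
        gcongr
        · rw [integral_exp_relax hτ]
          nlinarith [Real.exp_pos (-t / τ)]
        · exact integral_exp_relax_mul_le hτ ht
    _ = τ * (c + Λ * τ) := by ring

/-! ### Duhamel integrals -/

theorem intervalIntegrable_S {t : ℝ} {F : ℝ → L2 ℂ} (hF : IntervalIntegrable F volume 0 t) :
    IntervalIntegrable (fun s => S (t - s) (F s)) volume 0 t := by
  have hm : ∀ {μ : Measure ℝ}, AEStronglyMeasurable F μ →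
      AEStronglyMeasurable (fun s => S (t - s) (F s)) μ := fun {μ} h =>
    continuous_S.comp_aestronglyMeasurable (f := fun s => (t - s, F s))
      ((Continuous.aestronglyMeasurable (continuous_const.sub continuous_id)).prodMk h)
  exact ⟨hF.1.congr' (hm hF.1.aestronglyMeasurable)
      (Eventually.of_forall fun s => (norm_S _ _).symm),
    hF.2.congr' (hm hF.2.aestronglyMeasurable)
      (Eventually.of_forall fun s => (norm_S _ _).symm)⟩

theorem norm_integral_S_le {t : ℝ} (ht : 0 ≤ t) {F : ℝ → L2 ℂ} {b : ℝ → ℝ}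
    (hb : IntervalIntegrable b volume 0 t) (hFb : ∀ s ∈ Ioc 0 t, ‖F s‖ ≤ b s) :
    ‖∫ s in (0 : ℝ)..t, S (t - s) (F s)‖ ≤ ∫ s in (0 : ℝ)..t, b s := by
  refine intervalIntegral.norm_integral_le_of_norm_le ht (Eventually.of_forall fun s hs => ?_) hb
  rw [norm_S]
  exact hFb s hs

/-- `L^∞` bound of a Duhamel integral through the dispersive estimate and duality. -/
theorem ae_norm_integral_S_le {t : ℝ} (ht : 0 ≤ t) {F : ℝ → L2 ℂ} {b : ℝ → ℝ}
    (hF : IntervalIntegrable F volume 0 t) (hb : IntervalIntegrable b volume 0 t)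
    (hb0 : 0 ≤ ∫ s in (0 : ℝ)..t, b s)
    (hFb : ∀ᵐ s, s ∈ Ioo 0 t → Integrable (F s) ∧
      (t - s) ^ (-(1 / 2) : ℝ) * ∫ x, ‖F s x‖ ≤ b s) :
    ∀ᵐ x, ‖(∫ s in (0 : ℝ)..t, S (t - s) (F s) : L2 ℂ) x‖ ≤ ∫ s in (0 : ℝ)..t, b s := by
  refine ae_norm_le_of_forall_inner _ hb0 fun g hg => ?_
  have h1 : inner ℂ g (∫ s in (0 : ℝ)..t, S (t - s) (F s))
      = ∫ s in (0 : ℝ)..t, inner ℂ g (S (t - s) (F s)) :=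
    ((innerSL ℂ g).intervalIntegral_comp_comm (intervalIntegrable_S hF)).symm
  rw [h1, ← intervalIntegral.integral_mul_const]
  refine intervalIntegral.norm_integral_le_of_norm_le ht ?_ (hb.mul_const _)
  have hne : ∀ᵐ s : ℝ, s ≠ t := by simp [ae_iff]
  filter_upwards [hFb, hne] with s hs hst hs0
  obtain ⟨hi, hle⟩ := hs ⟨hs0.1, lt_of_le_of_ne hs0.2 hst⟩
  refine (norm_inner_S_le_dispersive (sub_pos.mpr (lt_of_le_of_ne hs0.2 hst)) hi hg).trans ?_
  gcongr

/-! ### Products in `L²` -/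

section Products

variable {E E' E'' : Type*} [NormedAddCommGroup E] [NormedAddCommGroup E'] [NormedAddCommGroup E'']

theorem coeFn_toL2 {f : ℝ → E} (hf : MemLp f 2) : (toL2 f : ℝ → E) =ᵐ[volume] f := by
  rw [toL2, dif_pos hf]
  exact hf.coeFn_toLp

theorem norm_le_add_of_ae (f : L2 E) (k : L2 E') (l : L2 E'') {a b : ℝ} (ha : 0 ≤ a) (hb : 0 ≤ b)
    (h : ∀ᵐ x, ‖f x‖ ≤ a * ‖k x‖ + b * ‖l x‖) : ‖f‖ ≤ a * ‖k‖ + b * ‖l‖ := by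
  have hk : MemLp (fun x => a * ‖k x‖) 2 := (Lp.memLp k).norm.const_mul a
  have hl : MemLp (fun x => b * ‖l x‖) 2 := (Lp.memLp l).norm.const_mul b
  have h1 : ‖f‖ ≤ ‖(hk.toLp _ + hl.toLp _ : L2 ℝ)‖ := by
    refine Lp.norm_le_norm_of_ae_le ?_
    filter_upwards [h, Lp.coeFn_add (hk.toLp _) (hl.toLp _), hk.coeFn_toLp, hl.coeFn_toLp]
      with x h1 h2 h3 h4
    rw [h2, Pi.add_apply, h3, h4]
    exact h1.trans (le_abs_self _)
  have h2 : ‖(hk.toLp _ : L2 ℝ)‖ ≤ a * ‖k‖ := by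
    refine Lp.norm_le_mul_norm_of_ae_le_mul ?_
    filter_upwards [hk.coeFn_toLp] with x hx
    rw [hx, norm_mul, norm_norm, Real.norm_of_nonneg ha]
  have h3 : ‖(hl.toLp _ : L2 ℝ)‖ ≤ b * ‖l‖ := by
    refine Lp.norm_le_mul_norm_of_ae_le_mul ?_
    filter_upwards [hl.coeFn_toLp] with x hx
    rw [hx, norm_mul, norm_norm, Real.norm_of_nonneg hb]
  exact h1.trans ((norm_add_le _ _).trans (add_le_add h2 h3))

theorem integrable_norm_mul_norm (f : L2 E) (g : L2 E') : Integrable fun x => ‖f x‖ * ‖g x‖ :=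
  (Lp.memLp f).norm.integrable_mul (Lp.memLp g).norm

theorem integral_norm_mul_norm_le (f : L2 E) (g : L2 E') :
    ∫ x, ‖f x‖ * ‖g x‖ ≤ ‖f‖ * ‖g‖ := by
  have hf := (Lp.memLp f).norm
  have hg := (Lp.memLp g).norm
  have h1 : inner ℝ (hg.toLp _ : L2 ℝ) (hf.toLp _ : L2 ℝ) = ∫ x, ‖f x‖ * ‖g x‖ := by
    rw [L2.inner_def]
    refine integral_congr_ae ?_
    filter_upwards [hf.coeFn_toLp, hg.coeFn_toLp] with x h1 h2
    rw [h1, h2]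
    rfl
  rw [← h1]
  refine (real_inner_le_norm _ _).trans ?_
  rw [Lp.norm_toLp, Lp.norm_toLp, eLpNorm_norm, eLpNorm_norm, mul_comm, ← Lp.norm_def,
    ← Lp.norm_def]

theorem aestronglyMeasurable_norm_sq (f : L2 E) :
    AEStronglyMeasurable (fun x => ‖f x‖ ^ 2) volume :=
  (Lp.aestronglyMeasurable f).norm.pow 2

theorem memLp_norm_sq {f : L2 E} {c : ℝ} (hf : ∀ᵐ x, ‖f x‖ ≤ c) :
    MemLp (fun x => ‖f x‖ ^ 2) 2 := by
  refine (Lp.memLp f).of_le_mul (c := c) (aestronglyMeasurable_norm_sq f) ?_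
  filter_upwards [hf] with x hx
  rw [norm_pow, norm_norm, sq]
  gcongr

theorem norm_toL2_norm_sq_le {f : L2 E} {c : ℝ} (hf : ∀ᵐ x, ‖f x‖ ≤ c) :
    ‖toL2 fun x => ‖f x‖ ^ 2‖ ≤ c * ‖f‖ := by
  refine Lp.norm_le_mul_norm_of_ae_le_mul ?_
  filter_upwards [hf, coeFn_toL2 (memLp_norm_sq hf)] with x hx h
  rw [h, norm_pow, norm_norm, sq]
  gcongr

theorem norm_toL2_norm_sq_sub_le {f g : L2 E} {c c' : ℝ} (hf : ∀ᵐ x, ‖f x‖ ≤ c)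
    (hg : ∀ᵐ x, ‖g x‖ ≤ c') :
    ‖(toL2 fun x => ‖f x‖ ^ 2) - toL2 fun x => ‖g x‖ ^ 2‖ ≤ (c + c') * ‖f - g‖ := by
  refine Lp.norm_le_mul_norm_of_ae_le_mul ?_
  filter_upwards [hf, hg, coeFn_toL2 (memLp_norm_sq hf), coeFn_toL2 (memLp_norm_sq hg),
    Lp.coeFn_sub (toL2 fun x => ‖f x‖ ^ 2 : L2 ℝ) (toL2 fun x => ‖g x‖ ^ 2), Lp.coeFn_sub f g]
    with x h1 h2 h3 h4 h5 h6
  rw [h5, h6, Pi.sub_apply, Pi.sub_apply, h3, h4, sq_sub_sq, norm_mul,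
    Real.norm_of_nonneg (by positivity : 0 ≤ ‖f x‖ + ‖g x‖)]
  exact mul_le_mul (add_le_add h1 h2) (abs_norm_sub_norm_le _ _) (norm_nonneg _)
    (by linarith [norm_nonneg (f x), norm_nonneg (g x)])

/-- `u ↦ |u|²` preserves continuity into `L²` on sets where `u` is bounded in `L^∞`. -/
theorem continuousOn_toL2_norm_sq {s : Set ℝ} {u : ℝ → L2 E} {c : ℝ} (hu : ContinuousOn u s)
    (hc : ∀ t ∈ s, ∀ᵐ x, ‖u t x‖ ≤ c) :
    ContinuousOn (fun t => toL2 fun x => ‖u t x‖ ^ 2) s := by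
  intro t ht
  refine tendsto_iff_norm_sub_tendsto_zero.mpr ?_
  have h1 := ((tendsto_iff_norm_sub_tendsto_zero.mp (hu t ht)).const_mul (c + c))
  rw [mul_zero] at h1
  refine squeeze_zero' (Eventually.of_forall fun _ => norm_nonneg _) ?_ h1
  filter_upwards [self_mem_nhdsWithin] with r hr
  exact norm_toL2_norm_sq_sub_le (hc r hr) (hc t ht)

end Products

/-! ### Boundedness of the solution of the cubic equation -/

section NLS

theorem isClosed_setOf_ae_norm_le {c : ℝ} (hc : 0 ≤ c) :
    IsClosed {f : L2 ℂ | ∀ᵐ x, ‖f x‖ ≤ c} := by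
  have h : {f : L2 ℂ | ∀ᵐ x, ‖f x‖ ≤ c}
      = ⋂ (g : L2 ℂ) (_ : Integrable g), {f : L2 ℂ | ‖inner ℂ g f‖ ≤ c * ∫ x, ‖g x‖} := by
    ext f
    simp only [mem_iInter, mem_ofPred_eq]
    exact ⟨fun hf g hg => norm_inner_le_of_ae_norm_le hf hg, ae_norm_le_of_forall_inner f hc⟩
  rw [h]
  refine isClosed_iInter fun g => isClosed_iInter fun _ => isClosed_le ?_ continuous_const
  fun_prop

theorem eLpNorm_top_le_iff (f : L2 ℂ) {c : ℝ} (hc : 0 ≤ c) :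
    eLpNorm f ∞ volume ≤ ENNReal.ofReal c ↔ ∀ᵐ x, ‖f x‖ ≤ c := by
  constructor
  · intro h
    rw [eLpNorm_exponent_top] at h
    filter_upwards [enorm_ae_le_eLpNormEssSup f volume] with x hx
    have := hx.trans h
    rwa [← ofReal_norm, ENNReal.ofReal_le_ofReal_iff hc] at this
  · intro h
    exact (eLpNorm_le_of_ae_bound h).trans (by simp)

theorem aemeasurable_eLpNorm_top {u : ℝ → L2 ℂ} {T : ℝ} (hu : ContinuousOn u (Icc 0 T)) :
    AEMeasurable (fun s => eLpNorm (u s) ∞ volume) (volume.restrict (Icc 0 T)) := by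
  refine aemeasurable_restrict_of_measurable_subtype measurableSet_Icc
    (measurable_of_Iic fun c => ?_)
  rcases eq_or_ne c ∞ with rfl | hc
  · simp
  · have h : (fun s : Icc (0 : ℝ) T => eLpNorm (u s) ∞ volume) ⁻¹' Iic c
        = (fun s : Icc (0 : ℝ) T => u s) ⁻¹' {f : L2 ℂ | ∀ᵐ x, ‖f x‖ ≤ c.toReal} := by
      ext s
      rw [mem_preimage, mem_Iic, mem_preimage, mem_ofPred_eq,
        ← eLpNorm_top_le_iff _ ENNReal.toReal_nonneg, ENNReal.ofReal_toReal hc]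
    rw [h]
    exact ((isClosed_setOf_ae_norm_le ENNReal.toReal_nonneg).preimage
      (continuousOn_iff_continuous_domRestrict.mp hu)).measurableSet

variable {u₀ : H1 ℂ} {u : ℝ → L2 ℂ} {T : ℝ}

theorem IsNLSSolution.intervalIntegrable (h : IsNLSSolution (-1) u₀.fn u) {t : ℝ} (ht : 0 ≤ t) :
    IntervalIntegrable (fun s => toL2 fun x => ((‖u s x‖ ^ 2 : ℝ) : ℂ) * u s x) volume 0 t := by
  rcases ht.eq_or_lt with rfl | ht'
  · exact IntervalIntegrable.refl
  · rw [intervalIntegrable_iff_integrableOn_Icc_of_le ht]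
    exact h.integrable t ht'

theorem IsNLSSolution.duhamel' (h : IsNLSSolution (-1) u₀.fn u) {t : ℝ} (ht : 0 ≤ t) :
    u t = S t u₀.fn + Complex.I • ∫ s in (0 : ℝ)..t,
      S (t - s) (toL2 fun x => ((‖u s x‖ ^ 2 : ℝ) : ℂ) * u s x) := by
  rw [h.duhamel t ht]
  simp_rw [S_smul]
  rw [intervalIntegral.integral_smul]
  simp

theorem aestronglyMeasurable_cubic (f : L2 ℂ) :
    AEStronglyMeasurable (fun x => ((‖f x‖ ^ 2 : ℝ) : ℂ) * f x) volume :=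
  (Complex.continuous_ofReal.comp_aestronglyMeasurable (aestronglyMeasurable_norm_sq f)).mul
    (Lp.aestronglyMeasurable f)

theorem norm_cubic (z : ℂ) : ‖((‖z‖ ^ 2 : ℝ) : ℂ) * z‖ = ‖z‖ * (‖z‖ * ‖z‖) := by
  rw [norm_mul, Complex.norm_real, norm_pow, norm_norm]
  ring

theorem memLp_cubic {f : L2 ℂ} {b : ℝ} (hf : ∀ᵐ x, ‖f x‖ ≤ b) :
    MemLp (fun x => ((‖f x‖ ^ 2 : ℝ) : ℂ) * f x) 2 := by
  refine (Lp.memLp f).of_le_mul (c := b ^ 2) (aestronglyMeasurable_cubic f) ?_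
  filter_upwards [hf] with x hx
  rw [norm_mul, Complex.norm_real, norm_pow, norm_norm]
  gcongr

theorem integrable_toL2_cubic {f : L2 ℂ} {b : ℝ} (hf : ∀ᵐ x, ‖f x‖ ≤ b) :
    Integrable (toL2 fun x => ((‖f x‖ ^ 2 : ℝ) : ℂ) * f x) ∧
      ∫ x, ‖(toL2 fun x => ((‖f x‖ ^ 2 : ℝ) : ℂ) * f x) x‖ ≤ b * ‖f‖ ^ 2 := by
  have hae := coeFn_toL2 (memLp_cubic hf)
  have hi : Integrable fun x => b * (‖f x‖ * ‖f x‖) := (integrable_norm_mul_norm f f).const_mul b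
  have hle : ∀ᵐ x, ‖(toL2 fun x => ((‖f x‖ ^ 2 : ℝ) : ℂ) * f x) x‖ ≤ b * (‖f x‖ * ‖f x‖) := by
    filter_upwards [hae, hf] with x h1 h2
    rw [h1, norm_cubic]
    gcongr
  have hint := hi.mono' (Lp.aestronglyMeasurable _) hle
  refine ⟨hint, ?_⟩
  calc _ ≤ ∫ x, b * (‖f x‖ * ‖f x‖) := integral_mono_ae hint.norm hi hle
    _ = b * ‖f‖ ^ 2 := by
        rw [integral_const_mul, L2.norm_sq_eq_integral]
        simp_rw [sq]

/-- A solution of the cubic equation with `H¹` data is bounded in space and time: this upgrades the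
`L⁴_t L^∞_x` integrability through Duhamel's formula and the dispersive estimate, since
`d^{-1/2}` pairs with `L⁴` functions of time. -/
theorem IsNLSSolution.exists_ae_norm_le (h : IsNLSSolution (-1) u₀.fn u) (hT : 0 < T) :
    ∃ B : ℝ, 0 ≤ B ∧ ∀ t ∈ Icc 0 T, ∀ᵐ x, ‖u t x‖ ≤ B := by
  have huc : ContinuousOn u (Icc 0 T) := h.continuousOn.mono fun t ht => ht.1
  obtain ⟨M, hM⟩ := isCompact_Icc.exists_bound_of_continuousOn huc
  have hM0 : 0 ≤ M := (norm_nonneg _).trans (hM 0 ⟨le_rfl, hT.le⟩)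
  set n : ℝ → ℝ≥0∞ := fun s => eLpNorm (u s) ∞ volume with hn
  have hmeas : AEMeasurable n (volume.restrict (Icc 0 T)) := aemeasurable_eLpNorm_top huc
  have hfin : ∀ᵐ s ∂volume.restrict (Icc 0 T), n s < ∞ := by
    filter_upwards [ae_lt_top' (hmeas.pow_const 4) (h.strichartz T hT).ne] with s hs
    by_contra hcon
    rw [not_lt, top_le_iff] at hcon
    rw [hcon] at hs
    simp at hs
  have h4 : IntegrableOn (fun s => (n s).toReal ^ 4) (Icc 0 T) := by
    have := integrable_toReal_of_lintegral_ne_top (hmeas.pow_const 4) (h.strichartz T hT).ne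
    simp only [ENNReal.toReal_pow] at this
    exact this
  set J := ∫ s in (0 : ℝ)..T, (n s).toReal ^ 4 with hJ
  have hJ0 : 0 ≤ J := intervalIntegral.integral_nonneg hT.le fun _ _ => by positivity
  set B := 3 * ‖u₀‖ + M ^ 2 * (4 * T ^ (1 / 4 : ℝ) + T + J) with hB
  refine ⟨B, by positivity, fun t ht => ?_⟩
  set b : ℝ → ℝ := fun s => M ^ 2 * ((t - s) ^ (-(3 / 4) : ℝ) + 1 + (n s).toReal ^ 4) with hb
  have h4t : IntervalIntegrable (fun s => (n s).toReal ^ 4) volume 0 t := by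
    rw [intervalIntegrable_iff_integrableOn_Icc_of_le ht.1]
    exact h4.mono_set (Icc_subset_Icc_right ht.2)
  have hbi : IntervalIntegrable b volume 0 t :=
    (((intervalIntegrable_sub_rpow t).add intervalIntegrable_const).add h4t).const_mul _
  have hbv : ∫ s in (0 : ℝ)..t, b s
      = M ^ 2 * (4 * t ^ (1 / 4 : ℝ) + t + ∫ s in (0 : ℝ)..t, (n s).toReal ^ 4) := by
    rw [hb, intervalIntegral.integral_const_mul,
      intervalIntegral.integral_add ((intervalIntegrable_sub_rpow t).add intervalIntegrable_const)
        h4t, intervalIntegral.integral_add (intervalIntegrable_sub_rpow t)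
        intervalIntegrable_const, integral_sub_rpow]
    simp
  have hb0 : 0 ≤ ∫ s in (0 : ℝ)..t, b s :=
    intervalIntegral.integral_nonneg ht.1 fun s hs => by
      have : 0 ≤ (t - s) ^ (-(3 / 4) : ℝ) := Real.rpow_nonneg (by linarith [hs.2]) _
      positivity
  have hbB : ∫ s in (0 : ℝ)..t, b s ≤ M ^ 2 * (4 * T ^ (1 / 4 : ℝ) + T + J) := by
    rw [hbv]
    have h1 : ∫ s in (0 : ℝ)..t, (n s).toReal ^ 4 ≤ J := by
      refine intervalIntegral.integral_mono_interval le_rfl ht.1 ht.2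
        (Eventually.of_forall fun s => by positivity) ?_
      rwa [intervalIntegrable_iff_integrableOn_Icc_of_le hT.le]
    have ht1 := ht.1
    have ht2 := ht.2
    gcongr
  have hDu := ae_norm_integral_S_le ht.1 (h.intervalIntegrable ht.1) hbi hb0 (by
    rw [ae_restrict_iff' measurableSet_Icc] at hfin
    filter_upwards [hfin] with s hs hst
    have hsT : s ∈ Icc 0 T := ⟨hst.1.le, hst.2.le.trans ht.2⟩
    have hus : ∀ᵐ x, ‖u s x‖ ≤ (n s).toReal := by
      rw [← eLpNorm_top_le_iff _ ENNReal.toReal_nonneg, ENNReal.ofReal_toReal (hs hsT).ne]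
    obtain ⟨hi, hle⟩ := integrable_toL2_cubic hus
    refine ⟨hi, ?_⟩
    have hd : 0 < t - s := sub_pos.mpr hst.2
    have hn0 : 0 ≤ (n s).toReal := ENNReal.toReal_nonneg
    calc _ ≤ (t - s) ^ (-(1 / 2) : ℝ) * ((n s).toReal * M ^ 2) := by
          gcongr
          refine hle.trans ?_
          gcongr
          exact hM s hsT
      _ = M ^ 2 * ((t - s) ^ (-(1 / 2) : ℝ) * (n s).toReal) := by ring
      _ ≤ b s := by
          refine mul_le_mul_of_nonneg_left ?_ (sq_nonneg M)
          have h5 := rpow_mul_le_young hd hn0 one_pos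
          have h6 : (n s).toReal ^ 3 ≤ 1 + (n s).toReal ^ 4 := by
            rcases le_total (n s).toReal 1 with h7 | h7
            · have : (n s).toReal ^ 3 ≤ 1 := pow_le_one₀ hn0 h7
              have : 0 ≤ (n s).toReal ^ 4 := by positivity
              linarith
            · have : (n s).toReal ^ 3 ≤ (n s).toReal ^ 4 := pow_le_pow_right₀ h7 (by norm_num)
              linarith
          simp only [one_pow, inv_one, one_mul] at h5
          linarith)
  have hD := h.duhamel' ht.1
  have hsum := Lp.coeFn_add (S t u₀.fn) (Complex.I • ∫ s in (0 : ℝ)..t,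
      S (t - s) (toL2 fun x => ((‖u s x‖ ^ 2 : ℝ) : ℂ) * u s x))
  rw [← hD] at hsum
  filter_upwards [hDu, ae_norm_S_fn_le t u₀, hsum, Lp.coeFn_smul Complex.I (∫ s in (0 : ℝ)..t,
      S (t - s) (toL2 fun x => ((‖u s x‖ ^ 2 : ℝ) : ℂ) * u s x))] with x h1 h2 h3 h4
  rw [h3, Pi.add_apply, h4, Pi.smul_apply]
  refine (norm_add_le _ _).trans ?_
  rw [norm_smul, Complex.norm_I, one_mul, hB]
  linarith

theorem IsNLSSolution.apply_zero (h : IsNLSSolution (-1) u₀.fn u) : u 0 = u₀.fn := by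
  rw [h.duhamel' le_rfl, intervalIntegral.integral_same, smul_zero, add_zero, S_zero]

end NLS

/-! ### The difference of the two nonlinearities and the energy -/

section NonlinearDifference

theorem memLp_mul_real {f : L2 ℂ} {c : ℝ} (hf : ∀ᵐ x, ‖f x‖ ≤ c) (v : L2 ℝ) :
    MemLp (fun x => f x * (v x : ℂ)) 2 := by
  refine (Lp.memLp v).of_le_mul (c := c) ((Lp.aestronglyMeasurable f).mul
    (Complex.continuous_ofReal.comp_aestronglyMeasurable (Lp.aestronglyMeasurable v))) ?_
  filter_upwards [hf] with x hx
  rw [norm_mul, Complex.norm_real]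
  gcongr

variable {f h : L2 ℂ} {c c' : ℝ} (v : L2 ℝ)

/-- The identity `f v + |h|² h = f (v + |h|²) - (f - h) |h|²` behind all difference estimates. -/
theorem ae_norm_nonlinear_add_le (hf : ∀ᵐ x, ‖f x‖ ≤ c) (hh : ∀ᵐ x, ‖h x‖ ≤ c') :
    ∀ᵐ x, ‖((toL2 fun x => f x * (v x : ℂ)) + toL2 fun x => ((‖h x‖ ^ 2 : ℝ) : ℂ) * h x : L2 ℂ) x‖
      ≤ ‖f x‖ * ‖(v + toL2 fun x => ‖h x‖ ^ 2 : L2 ℝ) x‖ + ‖(f - h) x‖ * ‖h x‖ ^ 2 := by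
  filter_upwards [coeFn_toL2 (memLp_mul_real hf v), coeFn_toL2 (memLp_cubic hh),
    coeFn_toL2 (memLp_norm_sq hh), Lp.coeFn_sub f h,
    Lp.coeFn_add v (toL2 fun x => ‖h x‖ ^ 2),
    Lp.coeFn_add (toL2 fun x => f x * (v x : ℂ)) (toL2 fun x => ((‖h x‖ ^ 2 : ℝ) : ℂ) * h x)]
    with x h1 h2 h3 h4 h5 h6
  rw [h6, h5, h4, Pi.add_apply, Pi.add_apply, Pi.sub_apply, h1, h2, h3]
  have e : f x * (v x : ℂ) + ((‖h x‖ ^ 2 : ℝ) : ℂ) * h x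
      = f x * ((v x + ‖h x‖ ^ 2 : ℝ) : ℂ) - (f x - h x) * ((‖h x‖ ^ 2 : ℝ) : ℂ) := by
    push_cast
    ring
  rw [e]
  refine (norm_sub_le _ _).trans (le_of_eq ?_)
  rw [norm_mul, norm_mul, Complex.norm_real, Complex.norm_real, norm_pow, norm_norm]

theorem norm_nonlinear_add_le (hc : 0 ≤ c) (hf : ∀ᵐ x, ‖f x‖ ≤ c) (hh : ∀ᵐ x, ‖h x‖ ≤ c') :
    ‖((toL2 fun x => f x * (v x : ℂ)) + toL2 fun x => ((‖h x‖ ^ 2 : ℝ) : ℂ) * h x : L2 ℂ)‖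
      ≤ c * ‖v + toL2 fun x => ‖h x‖ ^ 2‖ + c' ^ 2 * ‖f - h‖ := by
  refine norm_le_add_of_ae _ _ _ hc (sq_nonneg _) ?_
  filter_upwards [ae_norm_nonlinear_add_le v hf hh, hf, hh] with x h1 h2 h3
  refine h1.trans ?_
  rw [mul_comm ‖(f - h) x‖]
  gcongr

theorem integral_norm_nonlinear_add_le (hc' : 0 ≤ c') (hf : ∀ᵐ x, ‖f x‖ ≤ c)
    (hh : ∀ᵐ x, ‖h x‖ ≤ c') :
    Integrable ((toL2 fun x => f x * (v x : ℂ))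
        + toL2 fun x => ((‖h x‖ ^ 2 : ℝ) : ℂ) * h x : L2 ℂ) ∧
      ∫ x, ‖((toL2 fun x => f x * (v x : ℂ))
          + toL2 fun x => ((‖h x‖ ^ 2 : ℝ) : ℂ) * h x : L2 ℂ) x‖
        ≤ ‖f‖ * ‖v + toL2 fun x => ‖h x‖ ^ 2‖ + c' * (‖f - h‖ * ‖h‖) := by
  have i1 := integrable_norm_mul_norm f (v + toL2 fun x => ‖h x‖ ^ 2)
  have i2 := (integrable_norm_mul_norm (f - h) h).const_mul c'
  have hle : ∀ᵐ x, ‖((toL2 fun x => f x * (v x : ℂ))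
      + toL2 fun x => ((‖h x‖ ^ 2 : ℝ) : ℂ) * h x : L2 ℂ) x‖
      ≤ ‖f x‖ * ‖(v + toL2 fun x => ‖h x‖ ^ 2 : L2 ℝ) x‖ + c' * (‖(f - h) x‖ * ‖h x‖) := by
    filter_upwards [ae_norm_nonlinear_add_le v hf hh, hh] with x h1 h3
    refine h1.trans ?_
    have : ‖(f - h) x‖ * ‖h x‖ ^ 2 ≤ c' * (‖(f - h) x‖ * ‖h x‖) := by
      calc _ = ‖h x‖ * (‖(f - h) x‖ * ‖h x‖) := by ring
        _ ≤ _ := by gcongr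
    linarith
  have hint := (i1.add i2).mono' (Lp.aestronglyMeasurable _) hle
  refine ⟨hint, (integral_mono_ae hint.norm (i1.add i2) hle).trans ?_⟩
  simp only [Pi.add_apply]
  rw [integral_add i1 i2, integral_const_mul]
  gcongr
  · exact integral_norm_mul_norm_le _ _
  · exact integral_norm_mul_norm_le _ _

end NonlinearDifference

theorem continuousOn_toL2_mul {u : ℝ → H1 ℂ} {v : ℝ → H1 ℝ} {s : Set ℝ} (hu : ContinuousOn u s)
    (hv : ContinuousOn v s) :
    ContinuousOn (fun t => toL2 fun x => (u t).fn x * ((v t).fn x : ℂ)) s := by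
  intro t ht
  refine tendsto_iff_norm_sub_tendsto_zero.mpr ?_
  have hv' : ContinuousWithinAt (fun r => (v r).fn) s t :=
    H1.continuous_fn.continuousAt.comp_continuousWithinAt (hv t ht)
  have h1 : Tendsto (fun r => 3 * ‖u r - u t‖ * ‖(v r).fn‖ + 3 * ‖u t‖ * ‖(v r).fn - (v t).fn‖)
      (𝓝[s] t) (𝓝 (3 * 0 * ‖(v t).fn‖ + 3 * ‖u t‖ * 0)) :=
    (((tendsto_iff_norm_sub_tendsto_zero.mp (hu t ht)).const_mul 3).mul hv'.norm).add
      ((tendsto_iff_norm_sub_tendsto_zero.mp hv').const_mul _)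
  simp only [mul_zero, zero_mul, add_zero] at h1
  refine squeeze_zero (fun _ => norm_nonneg _) (fun r => ?_) h1
  refine norm_le_add_of_ae _ _ _ (by positivity) (by positivity) ?_
  filter_upwards [(u r - u t).ae_norm_fn_le, (u t).ae_norm_fn_le,
    coeFn_toL2 (memLp_mul_real (u r).ae_norm_fn_le (v r).fn),
    coeFn_toL2 (memLp_mul_real (u t).ae_norm_fn_le (v t).fn),
    Lp.coeFn_sub (toL2 fun x => (u r).fn x * ((v r).fn x : ℂ))
      (toL2 fun x => (u t).fn x * ((v t).fn x : ℂ)),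
    Lp.coeFn_sub (v r).fn (v t).fn, Lp.coeFn_sub (u r).fn (u t).fn] with x h1 h2 h3 h4 h5 h6 h7
  rw [H1.fn_sub, h7, Pi.sub_apply] at h1
  rw [h5, h6, Pi.sub_apply, Pi.sub_apply, h3, h4]
  have e : (u r).fn x * ((v r).fn x : ℂ) - (u t).fn x * ((v t).fn x : ℂ)
      = ((u r).fn x - (u t).fn x) * ((v r).fn x : ℂ)
        + (u t).fn x * (((v r).fn x - (v t).fn x : ℝ) : ℂ) := by
    push_cast
    ring
  rw [e]
  refine (norm_add_le _ _).trans ?_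
  rw [norm_mul, norm_mul, Complex.norm_real, Complex.norm_real]
  gcongr

section Difference

variable {u₀ u₀τ : H1 ℂ} {v₀τ : H1 ℝ} {u : ℝ → L2 ℂ} {uτ : ℝ → H1 ℂ} {vτ : ℝ → H1 ℝ} {τ : ℝ}

/-- Duhamel's formula for the difference of the two solutions. -/
theorem duhamel_sub (hSD : IsSDSolution (-1) τ u₀τ v₀τ uτ vτ) (hNLS : IsNLSSolution (-1) u₀.fn u)
    {t : ℝ} (ht : 0 ≤ t) :
    IntervalIntegrable (fun s => (toL2 fun x => (uτ s).fn x * ((vτ s).fn x : ℂ))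
        + toL2 fun x => ((‖u s x‖ ^ 2 : ℝ) : ℂ) * u s x) volume 0 t ∧
    (uτ t).fn - u t = S t (u₀τ - u₀).fn - Complex.I • ∫ s in (0 : ℝ)..t, S (t - s)
      ((toL2 fun x => (uτ s).fn x * ((vτ s).fn x : ℂ))
        + toL2 fun x => ((‖u s x‖ ^ 2 : ℝ) : ℂ) * u s x) := by
  have hsub : uIcc 0 t ⊆ Ici 0 := by
    rw [uIcc_of_le ht]
    exact fun s hs => hs.1
  have i1 : IntervalIntegrable (fun s => toL2 fun x => (uτ s).fn x * ((vτ s).fn x : ℂ))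
      volume 0 t :=
    (continuousOn_toL2_mul (hSD.continuousOn_u.mono hsub)
      (hSD.continuousOn_v.mono hsub)).intervalIntegrable
  have i2 := hNLS.intervalIntegrable ht
  refine ⟨i1.add i2, ?_⟩
  simp_rw [S_add]
  rw [intervalIntegral.integral_add (intervalIntegrable_S i1) (intervalIntegrable_S i2),
    hSD.duhamel_u t ht, hNLS.duhamel' ht, H1.fn_sub, S_sub, smul_add]
  abel

end Difference

/-- A nonpositive energy controls the `L²` norm of `v` through `‖v‖² ≤ -2 ∫ v |u|²`. -/
theorem norm_fn_le_of_energy_nonpos {u : H1 ℂ} {v : H1 ℝ} (h : energy (-1) u v ≤ 0) :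
    ‖v.fn‖ ≤ 6 * ‖u‖ ^ 2 := by
  have hu := u.ae_norm_fn_le
  set g : L2 ℝ := toL2 fun x => ‖u.fn x‖ ^ 2 with hg
  have hgae := coeFn_toL2 (memLp_norm_sq hu)
  have hgn : ‖g‖ ≤ 3 * ‖u‖ ^ 2 := by
    refine (norm_toL2_norm_sq_le hu).trans ?_
    have := u.norm_fn_le
    calc 3 * ‖u‖ * ‖u.fn‖ ≤ 3 * ‖u‖ * ‖u‖ := by gcongr
      _ = _ := by ring
  have i1 := L2.integrable_norm_sq u.wderiv
  have i2 : Integrable fun x => 2 * v.fn x * ‖u.fn x‖ ^ 2 := by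
    have : Integrable fun x => v.fn x * g x := (Lp.memLp v.fn).integrable_mul (Lp.memLp g)
    refine (this.const_mul 2).congr ?_
    filter_upwards [hgae] with x hx
    rw [hx]
    ring
  have i3 := L2.integrable_norm_sq v.fn
  have h1 : energy (-1) u v = ‖u.wderiv‖ ^ 2 + (∫ x, 2 * v.fn x * ‖u.fn x‖ ^ 2) + ‖v.fn‖ ^ 2 := by
    have i12 : Integrable fun x => ‖u.wderiv x‖ ^ 2 + 2 * v.fn x * ‖u.fn x‖ ^ 2 := i1.add i2
    rw [L2.norm_sq_eq_integral, L2.norm_sq_eq_integral, ← integral_add i1 i2,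
      ← integral_add i12 i3]
    refine integral_congr_ae (Eventually.of_forall fun x => ?_)
    simp only [Real.norm_eq_abs, sq_abs]
    ring
  have h2 : |∫ x, 2 * v.fn x * ‖u.fn x‖ ^ 2| ≤ 2 * (‖v.fn‖ * ‖g‖) := by
    have h3 := integral_norm_mul_norm_le v.fn g
    have h4 : ‖∫ x, 2 * v.fn x * ‖u.fn x‖ ^ 2‖ ≤ ∫ x, 2 * (‖v.fn x‖ * ‖g x‖) := by
      refine norm_integral_le_of_norm_le ((integrable_norm_mul_norm v.fn g).const_mul 2) ?_
      filter_upwards [hgae] with x hx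
      rw [hx, norm_mul, norm_mul, Real.norm_ofNat]
      exact le_of_eq (by ring)
    rw [integral_const_mul] at h4
    exact h4.trans (by gcongr)
  have h5 : ‖v.fn‖ ^ 2 ≤ 2 * (‖v.fn‖ * ‖g‖) := by
    have := (abs_le.mp h2).1
    nlinarith [sq_nonneg ‖u.wderiv‖]
  rcases (norm_nonneg v.fn).eq_or_lt with h6 | h6
  · rw [← h6]
    positivity
  · have : ‖v.fn‖ ≤ 2 * ‖g‖ := by
      refine le_of_mul_le_mul_left ?_ h6
      nlinarith
    linarith

/-! ### Stability estimates at fixed `τ` -/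

section FixedRelaxation

variable {u₀ u₀τ : H1 ℂ} {v₀τ : H1 ℝ} {u : ℝ → L2 ℂ} {uτ : ℝ → H1 ℂ} {vτ : ℝ → H1 ℝ}
  {τ r T b B V G η Λ : ℝ}

/-- Deviation of `v_τ` from its equilibrium value `-|u|²`. The modulus of continuity of `|u|²` in
time is encoded by the pair `(η, Λ)`. -/
theorem norm_fn_add_sq_le (hSD : IsSDSolution (-1) τ u₀τ v₀τ uτ vτ) (hτ : 0 < τ) (hη : 0 ≤ η)
    (hΛ : 0 ≤ Λ) (hbB : 0 ≤ b + B) {t a : ℝ} (ht : 0 ≤ t)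
    (hB : ∀ s ∈ Icc 0 t, ∀ᵐ x, ‖u s x‖ ≤ B)
    (hb : ∀ s ∈ Icc 0 t, ∀ᵐ x, ‖(uτ s).fn x‖ ≤ b)
    (hmod : ∀ s ∈ Icc 0 t,
      ‖(toL2 fun x => ‖u t x‖ ^ 2) - toL2 fun x => ‖u s x‖ ^ 2‖ ≤ η + Λ * (t - s))
    (ha : ∀ s ∈ Icc 0 t, ‖(uτ s).fn - u s‖ ≤ a) :
    ‖(vτ t).fn + toL2 fun x => ‖u t x‖ ^ 2‖
      ≤ Real.exp (-t / τ) * (‖v₀τ.fn‖ + ‖toL2 fun x => ‖u t x‖ ^ 2‖)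
        + (η + Λ * τ + (b + B) * a) := by
  have ha0 : 0 ≤ a := (norm_nonneg _).trans (ha 0 ⟨le_rfl, ht⟩)
  have hcont : ContinuousOn (fun s => toL2 fun x => ‖(uτ s).fn x‖ ^ 2) (Icc 0 t) :=
    continuousOn_toL2_norm_sq
      (H1.continuous_fn.comp_continuousOn (hSD.continuousOn_u.mono fun s hs => hs.1)) hb
  have h := norm_relax_add_le (c := η + (b + B) * a) hτ ht (by positivity) hΛ v₀τ.fn
    (toL2 fun x => ‖u t x‖ ^ 2) hcont (fun s hs => ?_)
  · rw [hSD.duhamel_v t ht]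
    refine h.trans ?_
    have := norm_add_le v₀τ.fn (toL2 fun x => ‖u t x‖ ^ 2)
    have h2 : Real.exp (-t / τ) * ‖v₀τ.fn + toL2 fun x => ‖u t x‖ ^ 2‖
        ≤ Real.exp (-t / τ) * (‖v₀τ.fn‖ + ‖toL2 fun x => ‖u t x‖ ^ 2‖) := by gcongr
    linarith
  · have h1 := norm_toL2_norm_sq_sub_le (hb s hs) (hB s hs)
    have h2 := norm_sub_le_norm_sub_add_norm_sub (toL2 fun x => ‖u t x‖ ^ 2)
      (toL2 fun x => ‖u s x‖ ^ 2) (toL2 fun x => ‖(uτ s).fn x‖ ^ 2)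
    rw [norm_sub_rev (toL2 fun x => ‖u s x‖ ^ 2)] at h2
    have h3 : (b + B) * ‖(uτ s).fn - u s‖ ≤ (b + B) * a :=
      mul_le_mul_of_nonneg_left (ha s hs) hbB
    linarith [hmod s hs]

/-- `L²` stability as long as `u_τ` stays bounded by `b`. The nonlocal-in-time inequality is closed
in the weighted norm `sup e^{-λt} ‖u_τ(t) - u(t)‖`, with which the relaxation kernel is compatible
because the weight is increasing. -/
theorem norm_fn_sub_le (hSD : IsSDSolution (-1) τ u₀τ v₀τ uτ vτ)
    (hNLS : IsNLSSolution (-1) u₀.fn u) (hτ : 0 < τ) (hη : 0 ≤ η) (hΛ : 0 ≤ Λ) (hb0 : 0 < b)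
    (hB0 : 0 ≤ B) (hr : 0 ≤ r) (hrT : r ≤ T)
    (hB : ∀ s ∈ Icc 0 T, ∀ᵐ x, ‖u s x‖ ≤ B)
    (hG : ∀ s ∈ Icc 0 T, ‖toL2 fun x => ‖u s x‖ ^ 2‖ ≤ G) (hV : ‖v₀τ.fn‖ ≤ V)
    (hmod : ∀ s t, 0 ≤ s → s ≤ t → t ≤ T →
      ‖(toL2 fun x => ‖u t x‖ ^ 2) - toL2 fun x => ‖u s x‖ ^ 2‖ ≤ η + Λ * (t - s))
    (hb : ∀ s ∈ Icc 0 r, ∀ᵐ x, ‖(uτ s).fn x‖ ≤ b) {t : ℝ} (ht : t ∈ Icc 0 r) :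
    ‖(uτ t).fn - u t‖ ≤ 2 * (‖u₀τ - u₀‖ + b * ((V + G) * τ + (η + Λ * τ) * T))
      * Real.exp (2 * (b * (b + B) + B ^ 2) * t) := by
  set lam := 2 * (b * (b + B) + B ^ 2) with hlam
  have hlam0 : 0 < lam := by positivity
  have hV0 : 0 ≤ V := (norm_nonneg _).trans hV
  have hG0 : 0 ≤ G := (norm_nonneg _).trans (hG 0 ⟨le_rfl, hr.trans hrT⟩)
  set δ := ‖u₀τ - u₀‖ + b * ((V + G) * τ + (η + Λ * τ) * T) with hδ
  have hT0 : 0 ≤ T := hr.trans hrT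
  have hδ0 : 0 ≤ δ := by positivity
  have hcont : ContinuousOn (fun s => Real.exp (-(lam * s)) * ‖(uτ s).fn - u s‖) (Icc 0 r) := by
    refine ContinuousOn.mul (Continuous.continuousOn (by fun_prop)) (ContinuousOn.norm ?_)
    exact (H1.continuous_fn.comp_continuousOn (hSD.continuousOn_u.mono fun s hs => hs.1)).sub
      (hNLS.continuousOn.mono fun s hs => hs.1)
  obtain ⟨t₀, ht₀, hmax⟩ := isCompact_Icc.exists_isMaxOn ⟨0, le_rfl, hr⟩ hcont
  set N := Real.exp (-(lam * t₀)) * ‖(uτ t₀).fn - u t₀‖ with hN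
  have hN0 : 0 ≤ N := by positivity
  have hwN : ∀ s ∈ Icc 0 r, ‖(uτ s).fn - u s‖ ≤ N * Real.exp (lam * s) := fun s hs => by
    have h1 : Real.exp (-(lam * s)) * ‖(uτ s).fn - u s‖ ≤ N := hmax hs
    calc ‖(uτ s).fn - u s‖
        = (Real.exp (-(lam * s)) * ‖(uτ s).fn - u s‖) * Real.exp (lam * s) := by
          rw [mul_right_comm, ← Real.exp_add, neg_add_cancel, Real.exp_zero, one_mul]
      _ ≤ _ := by gcongr
  have hq : ∀ s ∈ Icc 0 r, ‖(vτ s).fn + toL2 fun x => ‖u s x‖ ^ 2‖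
      ≤ Real.exp (-s / τ) * (V + G) + (η + Λ * τ + (b + B) * (N * Real.exp (lam * s))) := by
    intro s hs
    have hsT : s ∈ Icc 0 T := ⟨hs.1, hs.2.trans hrT⟩
    refine (norm_fn_add_sq_le hSD hτ hη hΛ (by positivity) hs.1
      (fun σ hσ => hB σ ⟨hσ.1, hσ.2.trans hsT.2⟩) (fun σ hσ => hb σ ⟨hσ.1, hσ.2.trans hs.2⟩)
      (fun σ hσ => hmod σ s hσ.1 hσ.2 hsT.2)
      (a := N * Real.exp (lam * s)) (fun σ hσ => ?_)).trans ?_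
    · refine (hwN σ ⟨hσ.1, hσ.2.trans hs.2⟩).trans ?_
      have := hσ.2
      gcongr
    · have := hG s hsT
      gcongr
  set β : ℝ → ℝ := fun s => b * (V + G) * Real.exp (-s / τ) + b * (η + Λ * τ)
    + N / 2 * (lam * Real.exp (lam * s)) with hβ
  have hβv : ∀ t, ∫ s in (0 : ℝ)..t, β s = b * (V + G) * (∫ s in (0 : ℝ)..t, Real.exp (-s / τ))
      + b * (η + Λ * τ) * t + N / 2 * (Real.exp (lam * t) - 1) := fun t => by
    have h1 : ∫ s in (0 : ℝ)..t, lam * Real.exp (lam * s) = Real.exp (lam * t) - 1 := by simp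
    rw [hβ, intervalIntegral.integral_add (Continuous.intervalIntegrable (by fun_prop) _ _)
      (Continuous.intervalIntegrable (by fun_prop) _ _),
      intervalIntegral.integral_add (Continuous.intervalIntegrable (by fun_prop) _ _)
      (Continuous.intervalIntegrable (by fun_prop) _ _), intervalIntegral.integral_const_mul,
      intervalIntegral.integral_const_mul, intervalIntegral.integral_const,
      intervalIntegral.integral_const_mul, h1]
    simp only [sub_zero, smul_eq_mul]
    ring
  have hw0 : ‖S t₀ (u₀τ - u₀).fn‖ ≤ ‖u₀τ - u₀‖ := by
    rw [norm_S]
    exact H1.norm_fn_le _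
  have hmain : ‖(uτ t₀).fn - u t₀‖ ≤ δ + N * Real.exp (lam * t₀) / 2 := by
    rw [(duhamel_sub hSD hNLS ht₀.1).2]
    refine (norm_sub_le _ _).trans ?_
    rw [norm_smul, Complex.norm_I, one_mul]
    have h2 := norm_integral_S_le ht₀.1 (F := fun s =>
      (toL2 fun x => (uτ s).fn x * ((vτ s).fn x : ℂ))
        + toL2 fun x => ((‖u s x‖ ^ 2 : ℝ) : ℂ) * u s x) (b := β)
      (Continuous.intervalIntegrable (by rw [hβ]; fun_prop) _ _) (fun s hs => by
        have hsr : s ∈ Icc 0 r := ⟨hs.1.le, hs.2.trans ht₀.2⟩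
        refine (norm_nonlinear_add_le (vτ s).fn hb0.le (hb s hsr)
          (hB s ⟨hsr.1, hsr.2.trans hrT⟩)).trans ?_
        calc _ ≤ b * (Real.exp (-s / τ) * (V + G)
              + (η + Λ * τ + (b + B) * (N * Real.exp (lam * s))))
              + B ^ 2 * (N * Real.exp (lam * s)) := by
              gcongr
              · exact hq s hsr
              · exact hwN s hsr
          _ = β s := by
              simp only [hβ, hlam]
              ring)
    rw [hβv] at h2
    have h3 := integral_exp_neg_div_le hτ t₀
    have h4 : b * (V + G) * (∫ s in (0 : ℝ)..t₀, Real.exp (-s / τ)) ≤ b * (V + G) * τ := by gcongr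
    have h5 : b * (η + Λ * τ) * t₀ ≤ b * (η + Λ * τ) * T :=
      mul_le_mul_of_nonneg_left (ht₀.2.trans hrT) (by positivity)
    linarith
  have hN2 : N ≤ 2 * δ := by
    have h1 : N * Real.exp (lam * t₀) = ‖(uτ t₀).fn - u t₀‖ := by
      rw [hN, mul_right_comm, ← Real.exp_add, neg_add_cancel, Real.exp_zero, one_mul]
    have h2 : N * Real.exp (lam * t₀) ≤ 2 * δ := by
      rw [← h1] at hmain
      linarith
    have h3 : 1 ≤ Real.exp (lam * t₀) := Real.one_le_exp (mul_nonneg hlam0.le ht₀.1)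
    exact (le_mul_of_one_le_right hN0 h3).trans h2
  refine (hwN t ht).trans ?_
  gcongr

/-- `L^∞` bound of `u_τ - u` in terms of its `L²` size `a`, through the dispersive estimate. The
free parameter `κ` comes from Young's inequality for the initial layer `e^{-t/τ}`. -/
theorem ae_norm_fn_sub_le (hSD : IsSDSolution (-1) τ u₀τ v₀τ uτ vτ)
    (hNLS : IsNLSSolution (-1) u₀.fn u) (hτ : 0 < τ) (hη : 0 ≤ η) (hΛ : 0 ≤ Λ) (hb0 : 0 < b)
    (hB0 : 0 ≤ B) (hrT : r ≤ T) {M a κ : ℝ} (hκ : 0 < κ)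
    (hM : ∀ s ∈ Icc 0 T, ‖u s‖ ≤ M)
    (hB : ∀ s ∈ Icc 0 T, ∀ᵐ x, ‖u s x‖ ≤ B)
    (hG : ∀ s ∈ Icc 0 T, ‖toL2 fun x => ‖u s x‖ ^ 2‖ ≤ G) (hV : ‖v₀τ.fn‖ ≤ V)
    (hmod : ∀ s t, 0 ≤ s → s ≤ t → t ≤ T →
      ‖(toL2 fun x => ‖u t x‖ ^ 2) - toL2 fun x => ‖u s x‖ ^ 2‖ ≤ η + Λ * (t - s))
    (hb : ∀ s ∈ Icc 0 r, ∀ᵐ x, ‖(uτ s).fn x‖ ≤ b)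
    (ha : ∀ s ∈ Icc 0 r, ‖(uτ s).fn - u s‖ ≤ a) {t : ℝ} (ht : t ∈ Icc 0 r) :
    ∀ᵐ x, ‖((uτ t).fn - u t : L2 ℂ) x‖ ≤ 3 * ‖u₀τ - u₀‖
      + ((M + a) * (V + G) * (κ * (4 * T ^ (1 / 4 : ℝ)) + (κ ^ 2)⁻¹ * τ)
        + ((M + a) * (η + Λ * τ + (b + B) * a) + B * (a * M)) * (4 * T ^ (1 / 4 : ℝ) + T)) := by
  have hr : 0 ≤ r := ht.1.trans ht.2
  have hT0 : 0 ≤ T := hr.trans hrT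
  have hV0 : 0 ≤ V := (norm_nonneg _).trans hV
  have hG0 : 0 ≤ G := (norm_nonneg _).trans (hG 0 ⟨le_rfl, hT0⟩)
  have hM0 : 0 ≤ M := (norm_nonneg _).trans (hM 0 ⟨le_rfl, hT0⟩)
  have ha0 : 0 ≤ a := (norm_nonneg _).trans (ha 0 ⟨le_rfl, hr⟩)
  set c₁ := (M + a) * (V + G) with hc₁
  set c₂ := (M + a) * (η + Λ * τ + (b + B) * a) + B * (a * M) with hc₂
  have hc₁0 : 0 ≤ c₁ := by positivity
  have hc₂0 : 0 ≤ c₂ := by positivity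
  set β : ℝ → ℝ := fun s => c₁ * (κ * (t - s) ^ (-(3 / 4) : ℝ) + (κ ^ 2)⁻¹ * Real.exp (-s / τ))
    + c₂ * ((t - s) ^ (-(3 / 4) : ℝ) + 1) with hβ
  have i1 := intervalIntegrable_sub_rpow t
  have i2 : IntervalIntegrable (fun s => Real.exp (-s / τ)) volume 0 t :=
    Continuous.intervalIntegrable (by fun_prop) _ _
  have hβi : IntervalIntegrable β volume 0 t :=
    (((i1.const_mul _).add (i2.const_mul _)).const_mul _).add
      ((i1.add intervalIntegrable_const).const_mul _)
  have hβv : ∫ s in (0 : ℝ)..t, β s = c₁ * (κ * (4 * t ^ (1 / 4 : ℝ))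
      + (κ ^ 2)⁻¹ * ∫ s in (0 : ℝ)..t, Real.exp (-s / τ)) + c₂ * (4 * t ^ (1 / 4 : ℝ) + t) := by
    rw [hβ, intervalIntegral.integral_add (((i1.const_mul _).add (i2.const_mul _)).const_mul _)
      ((i1.add intervalIntegrable_const).const_mul _), intervalIntegral.integral_const_mul,
      intervalIntegral.integral_const_mul, intervalIntegral.integral_add (i1.const_mul _)
      (i2.const_mul _), intervalIntegral.integral_add i1 intervalIntegrable_const,
      intervalIntegral.integral_const_mul, intervalIntegral.integral_const_mul, integral_sub_rpow]
    simp
  have hβ0 : 0 ≤ ∫ s in (0 : ℝ)..t, β s :=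
    intervalIntegral.integral_nonneg ht.1 fun s hs => by
      have : 0 ≤ (t - s) ^ (-(3 / 4) : ℝ) := Real.rpow_nonneg (by linarith [hs.2]) _
      positivity
  have hβle : ∫ s in (0 : ℝ)..t, β s ≤ c₁ * (κ * (4 * T ^ (1 / 4 : ℝ)) + (κ ^ 2)⁻¹ * τ)
      + c₂ * (4 * T ^ (1 / 4 : ℝ) + T) := by
    rw [hβv]
    have h1 := ht.1
    have h2 : t ≤ T := ht.2.trans hrT
    have h3 := integral_exp_neg_div_le hτ t
    gcongr
  obtain ⟨hFi, hD⟩ := duhamel_sub hSD hNLS ht.1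
  have hDu := ae_norm_integral_S_le ht.1 hFi hβi hβ0 (Eventually.of_forall fun s hs => by
    have hsr : s ∈ Icc 0 r := ⟨hs.1.le, hs.2.le.trans ht.2⟩
    have hsT : s ∈ Icc 0 T := ⟨hsr.1, hsr.2.trans hrT⟩
    obtain ⟨hi, hle⟩ := integral_norm_nonlinear_add_le (vτ s).fn hB0 (hb s hsr) (hB s hsT)
    refine ⟨hi, ?_⟩
    have hd : 0 < t - s := sub_pos.mpr hs.2
    have hq := norm_fn_add_sq_le hSD hτ hη hΛ (by positivity) hsr.1
      (fun σ hσ => hB σ ⟨hσ.1, hσ.2.trans hsT.2⟩) (fun σ hσ => hb σ ⟨hσ.1, hσ.2.trans hsr.2⟩)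
      (fun σ hσ => hmod σ s hσ.1 hσ.2 hsT.2) (fun σ hσ => ha σ ⟨hσ.1, hσ.2.trans hsr.2⟩)
    have hnorm : ‖(uτ s).fn‖ ≤ M + a := by
      have := norm_add_le (u s) ((uτ s).fn - u s)
      rw [add_sub_cancel] at this
      linarith [hM s hsT, ha s hsr]
    have hL1 : ∫ x, ‖((toL2 fun x => (uτ s).fn x * ((vτ s).fn x : ℂ))
        + toL2 fun x => ((‖u s x‖ ^ 2 : ℝ) : ℂ) * u s x : L2 ℂ) x‖
        ≤ c₁ * Real.exp (-s / τ) + c₂ := by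
      refine hle.trans ?_
      calc _ ≤ (M + a) * (Real.exp (-s / τ) * (V + G) + (η + Λ * τ + (b + B) * a))
            + B * (a * M) := by
            gcongr
            · refine hq.trans ?_
              gcongr
              exact hG s hsT
            · exact ha s hsr
            · exact hM s hsT
        _ = _ := by
            rw [hc₁, hc₂]
            ring
    have hy : Real.exp (-s / τ) ^ 3 ≤ Real.exp (-s / τ) := by
      refine pow_le_of_le_one (Real.exp_pos _).le ?_ (by norm_num)
      rw [Real.exp_le_one_iff]
      exact div_nonpos_of_nonpos_of_nonneg (by linarith [hs.1]) hτ.le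
    have hy1 := rpow_mul_le_young hd (Real.exp_pos (-s / τ)).le hκ
    have hy2 := rpow_mul_le_young hd zero_le_one one_pos
    have hp : 0 ≤ (t - s) ^ (-(1 / 2) : ℝ) := Real.rpow_nonneg hd.le _
    calc _ ≤ (t - s) ^ (-(1 / 2) : ℝ) * (c₁ * Real.exp (-s / τ) + c₂) := by gcongr
      _ = c₁ * ((t - s) ^ (-(1 / 2) : ℝ) * Real.exp (-s / τ))
          + c₂ * ((t - s) ^ (-(1 / 2) : ℝ) * 1) := by ring
      _ ≤ c₁ * (κ * (t - s) ^ (-(3 / 4) : ℝ) + (κ ^ 2)⁻¹ * Real.exp (-s / τ) ^ 3)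
          + c₂ * (1 * (t - s) ^ (-(3 / 4) : ℝ) + (1 ^ 2)⁻¹ * 1 ^ 3) := by gcongr
      _ ≤ c₁ * (κ * (t - s) ^ (-(3 / 4) : ℝ) + (κ ^ 2)⁻¹ * Real.exp (-s / τ))
          + c₂ * (1 * (t - s) ^ (-(3 / 4) : ℝ) + (1 ^ 2)⁻¹ * 1 ^ 3) := by gcongr
      _ = β s := by
          simp only [hβ]
          ring)
  rw [hD]
  set I : L2 ℂ := ∫ s in (0 : ℝ)..t, S (t - s) ((toL2 fun x => (uτ s).fn x * ((vτ s).fn x : ℂ))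
        + toL2 fun x => ((‖u s x‖ ^ 2 : ℝ) : ℂ) * u s x) with hI
  filter_upwards [hDu, ae_norm_S_fn_le t (u₀τ - u₀), Lp.coeFn_smul Complex.I I,
    Lp.coeFn_sub (S t (u₀τ - u₀).fn) (Complex.I • I)] with x h1 h2 h3 h4
  rw [h4, Pi.sub_apply, h3, Pi.smul_apply]
  refine (norm_sub_le _ _).trans ?_
  rw [norm_smul, Complex.norm_I, one_mul]
  linarith

end FixedRelaxation

/-! ### Uniform closeness for small `τ` -/

/-- A continuous function on `[0, T]` has a modulus of continuity of the form `η + Λ d`, with `η`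
arbitrarily small. -/
theorem exists_norm_sub_le_add_mul {X : Type*} [NormedAddCommGroup X] {g : ℝ → X} {T : ℝ}
    (hg : ContinuousOn g (Icc 0 T)) {η : ℝ} (hη : 0 < η) :
    ∃ Λ, 0 ≤ Λ ∧ ∀ s t, 0 ≤ s → s ≤ t → t ≤ T → ‖g t - g s‖ ≤ η + Λ * (t - s) := by
  obtain ⟨C, hC⟩ := isCompact_Icc.exists_bound_of_continuousOn hg
  obtain ⟨d, hd, hu⟩ := Metric.uniformContinuousOn_iff.mp
    (isCompact_Icc.uniformContinuousOn_of_continuous hg) η hη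
  refine ⟨2 * |C| / d, by positivity, fun s t hs hst ht => ?_⟩
  have hsI : s ∈ Icc 0 T := ⟨hs, hst.trans ht⟩
  have htI : t ∈ Icc 0 T := ⟨hs.trans hst, ht⟩
  have h0 : 0 ≤ 2 * |C| / d * (t - s) := mul_nonneg (by positivity) (sub_nonneg.mpr hst)
  rcases lt_or_ge (t - s) d with h | h
  · have := hu t htI s hsI (by rwa [Real.dist_eq, abs_of_nonneg (sub_nonneg.mpr hst)])
    rw [dist_eq_norm] at this
    linarith
  · have h1 : 2 * |C| ≤ 2 * |C| / d * (t - s) := by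
      rw [div_mul_eq_mul_div, le_div_iff₀ hd]
      gcongr
    have h2 := norm_sub_le (g t) (g s)
    linarith [hC t htI, hC s hsI, le_abs_self C]

/-- Continuity argument: an `L^∞` bound that improves itself propagates from `t = 0` to `[0, T]`,
since `H¹`-continuity controls the `L^∞` norm on time steps of uniform length. -/
theorem ae_norm_fn_le_of_bootstrap {w : ℝ → H1 ℂ} {T b : ℝ} (hw : ContinuousOn w (Icc 0 T))
    (h0 : ∀ᵐ x, ‖(w 0).fn x‖ ≤ b + 1)
    (hstep : ∀ r ∈ Icc 0 T, (∀ s ∈ Icc 0 r, ∀ᵐ x, ‖(w s).fn x‖ ≤ b + 1) →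
      ∀ s ∈ Icc 0 r, ∀ᵐ x, ‖(w s).fn x‖ ≤ b + 1 / 2) :
    ∀ s ∈ Icc 0 T, ∀ᵐ x, ‖(w s).fn x‖ ≤ b + 1 := by
  obtain ⟨d, hd, hu⟩ := Metric.uniformContinuousOn_iff.mp
    (isCompact_Icc.uniformContinuousOn_of_continuous hw) (1 / 6) (by norm_num)
  have key : ∀ k : ℕ, ∀ s ∈ Icc 0 T, s ≤ k * (d / 2) → ∀ᵐ x, ‖(w s).fn x‖ ≤ b + 1 := by
    intro k
    induction k with
    | zero =>
      intro s hs hsk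
      have : s = 0 := le_antisymm (by simpa using hsk) hs.1
      rwa [this]
    | succ k ih =>
      intro s hs hsk
      rcases le_or_gt s (k * (d / 2)) with h | h
      · exact ih s hs h
      · have hr : (k : ℝ) * (d / 2) ∈ Icc 0 T := ⟨by positivity, h.le.trans hs.2⟩
        have h1 := hstep _ hr (fun σ hσ => ih σ ⟨hσ.1, hσ.2.trans hr.2⟩ hσ.2) _ ⟨hr.1, le_rfl⟩
        have h2 := hu s hs _ hr (by
          rw [Real.dist_eq, abs_of_pos (sub_pos.mpr h)]
          push_cast at hsk
          linarith)
        rw [dist_eq_norm] at h2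
        filter_upwards [h1, (w s - w (k * (d / 2))).ae_norm_fn_le,
          Lp.coeFn_sub (w s).fn (w (k * (d / 2))).fn] with x h3 h4 h5
        rw [H1.fn_sub, h5, Pi.sub_apply] at h4
        have h6 := norm_add_le ((w s).fn x - (w (k * (d / 2))).fn x) ((w (k * (d / 2))).fn x)
        rw [sub_add_cancel] at h6
        linarith
  intro s hs
  obtain ⟨k, hk⟩ := exists_nat_ge (s / (d / 2))
  exact key k s hs (by rwa [div_le_iff₀ (by positivity)] at hk)

section Limit

variable {u₀τ : ℝ → H1 ℂ} {v₀τ : ℝ → H1 ℝ} {u₀ : H1 ℂ} {uτ : ℝ → ℝ → H1 ℂ} {vτ : ℝ → ℝ → H1 ℝ}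
  {u : ℝ → L2 ℂ} {T V : ℝ}

/-- Uniform convergence on `[0, T]`, up to an initial layer in `v_τ`. -/
theorem eventually_close (hi : Tendsto (fun τ => ‖u₀τ τ - u₀‖) (𝓝[>] 0) (𝓝 0))
    (hV : ∀ᶠ τ in 𝓝[>] (0 : ℝ), ‖(v₀τ τ).fn‖ ≤ V)
    (hSD : ∀ τ ∈ Ioo (0 : ℝ) 1, IsSDSolution (-1) τ (u₀τ τ) (v₀τ τ) (uτ τ) (vτ τ))
    (hNLS : IsNLSSolution (-1) u₀.fn u) (hT : 0 < T) :
    ∃ K : ℝ, 0 ≤ K ∧ (∀ t ∈ Icc 0 T, ∃ B, ∀ᵐ x, ‖u t x‖ ≤ B) ∧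
      ∀ ε > 0, ∀ᶠ τ in 𝓝[>] (0 : ℝ), ∀ t ∈ Icc 0 T, ‖(uτ τ t).fn - u t‖ ≤ ε ∧
        ‖(vτ τ t).fn + toL2 fun x => ‖u t x‖ ^ 2‖ ≤ Real.exp (-t / τ) * K + ε := by
  obtain ⟨B, hB0, hB⟩ := hNLS.exists_ae_norm_le hT
  have huc : ContinuousOn u (Icc 0 T) := hNLS.continuousOn.mono fun t ht => ht.1
  obtain ⟨M, hM⟩ := isCompact_Icc.exists_bound_of_continuousOn huc
  have hgc := continuousOn_toL2_norm_sq huc hB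
  obtain ⟨G, hG⟩ := isCompact_Icc.exists_bound_of_continuousOn hgc
  have h0T : (0 : ℝ) ∈ Icc 0 T := ⟨le_rfl, hT.le⟩
  have hM0 : 0 ≤ M := (norm_nonneg _).trans (hM 0 h0T)
  have hG0 : 0 ≤ G := (norm_nonneg _).trans (hG 0 h0T)
  obtain ⟨τ₁, hτ₁⟩ := hV.exists
  have hV0 : 0 ≤ V := (norm_nonneg _).trans hτ₁
  refine ⟨V + G, by positivity, fun t ht => ⟨B, hB t ht⟩, fun ε hε => ?_⟩
  set b := B + 1 with hbdef
  have hb0 : 0 < b := by positivity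
  set lam := 2 * (b * (b + B) + B ^ 2) with hlam
  set Q := 4 * T ^ (1 / 4 : ℝ) with hQ
  have hQ0 : 0 ≤ Q := by positivity
  set P := M * (V + G) * Q with hP
  have hP0 : 0 ≤ P := by positivity
  set κ := 1 / (4 * (P + 1)) with hκdef
  have hκ : 0 < κ := by positivity
  have hκP : P * κ < 1 / 2 := by
    rw [hκdef, mul_one_div, div_lt_iff₀ (by positivity)]
    linarith
  -- the bounds of the two stability estimates, as functions of `(‖u₀τ - u₀‖, η + Λ τ, τ)`
  set A : ℝ × ℝ × ℝ → ℝ := fun p =>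
    2 * (p.1 + b * ((V + G) * p.2.2 + p.2.1 * T)) * Real.exp (lam * T) with hA
  set R : ℝ × ℝ × ℝ → ℝ := fun p => 3 * p.1
    + ((M + A p) * (V + G) * (κ * Q + (κ ^ 2)⁻¹ * p.2.2)
      + ((M + A p) * (p.2.1 + (b + B) * A p) + B * (A p * M)) * (Q + T)) with hR
  have hAc : Continuous A := by fun_prop
  have hRc : Continuous R := by fun_prop
  have hA0 : A (0, 0, 0) = 0 := by simp [hA]
  have hR0 : R (0, 0, 0) < 1 / 2 := by
    simp only [hR, hA0]
    calc _ = P * κ := by rw [hP]; ring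
      _ < _ := hκP
  have hnear : ∀ᶠ p in 𝓝 ((0, 0, 0) : ℝ × ℝ × ℝ),
      R p < 1 / 2 ∧ A p < ε ∧ p.2.1 + (b + B) * A p < ε := by
    refine ((hRc.tendsto _).eventually_lt_const hR0).and
      (((hAc.tendsto _).eventually_lt_const (by rwa [hA0])).and ?_)
    have hc : Continuous fun p : ℝ × ℝ × ℝ => p.2.1 + (b + B) * A p := by fun_prop
    exact (hc.tendsto _).eventually_lt_const (by simpa [hA0] using hε)
  obtain ⟨ρ, hρ, hball⟩ := Metric.eventually_nhds_iff.mp hnear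
  obtain ⟨Λ, hΛ, hmod⟩ := exists_norm_sub_le_add_mul hgc (half_pos hρ)
  have hτρ : ∀ᶠ τ in 𝓝[>] (0 : ℝ), τ < ρ ∧ Λ * τ < ρ / 2 := by
    refine eventually_nhdsWithin_of_eventually_nhds ?_
    have hc : Continuous fun τ : ℝ => Λ * τ := by fun_prop
    exact ((continuous_id.tendsto (0 : ℝ)).eventually_lt_const hρ).and
      ((hc.tendsto 0).eventually_lt_const (by simpa using half_pos hρ))
  filter_upwards [hi.eventually_lt_const hρ,
    hi.eventually_lt_const (show (0 : ℝ) < 1 / 3 by norm_num), hV, hτρ,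
    Ioo_mem_nhdsGT (zero_lt_one (α := ℝ))] with τ hh hh3 hVτ hτ hτ1
  have hτ0 : 0 < τ := hτ1.1
  have hS := hSD τ hτ1
  obtain ⟨hRp, hAp, hωp⟩ := hball (y := (‖u₀τ τ - u₀‖, ρ / 2 + Λ * τ, τ)) (by
    rw [Prod.dist_eq, Prod.dist_eq, max_lt_iff, max_lt_iff]
    simp only [Real.dist_eq, sub_zero]
    refine ⟨by rwa [abs_norm], ?_, by rw [abs_of_pos hτ0]; exact hτ.1⟩
    rw [abs_of_nonneg (by positivity)]
    linarith [hτ.2])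
  set a := A (‖u₀τ τ - u₀‖, ρ / 2 + Λ * τ, τ) with ha
  have hL2 : ∀ r ∈ Icc 0 T, (∀ s ∈ Icc 0 r, ∀ᵐ x, ‖(uτ τ s).fn x‖ ≤ b) →
      ∀ s ∈ Icc 0 r, ‖(uτ τ s).fn - u s‖ ≤ a := by
    intro r hr hbr s hs
    refine (norm_fn_sub_le hS hNLS hτ0 (half_pos hρ).le hΛ hb0 hB0 hr.1 hr.2 hB hG hVτ hmod hbr
      hs).trans ?_
    have hsT : s ≤ T := hs.2.trans hr.2
    simp only [ha, hA]
    gcongr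
  have hbdd : ∀ s ∈ Icc 0 T, ∀ᵐ x, ‖(uτ τ s).fn x‖ ≤ b := by
    refine ae_norm_fn_le_of_bootstrap (hS.continuousOn_u.mono fun s hs => hs.1) ?_ ?_
    · have h1 : (uτ τ 0).fn = (u₀τ τ).fn := by
        rw [hS.duhamel_u 0 le_rfl, intervalIntegral.integral_same, smul_zero, sub_zero, S_zero]
      have h2 := hB 0 h0T
      rw [hNLS.apply_zero] at h2
      rw [h1]
      filter_upwards [h2, (u₀τ τ - u₀).ae_norm_fn_le, Lp.coeFn_sub (u₀τ τ).fn u₀.fn]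
        with x h3 h4 h5
      rw [H1.fn_sub, h5, Pi.sub_apply] at h4
      have h6 := norm_add_le ((u₀τ τ).fn x - u₀.fn x) (u₀.fn x)
      rw [sub_add_cancel] at h6
      linarith
    · intro r hr hbr s hs
      have h1 := ae_norm_fn_sub_le hS hNLS hτ0 (half_pos hρ).le hΛ hb0 hB0 hr.2 hκ hM hB hG hVτ
        hmod hbr (hL2 r hr hbr) hs
      filter_upwards [h1, hB s ⟨hs.1, hs.2.trans hr.2⟩, Lp.coeFn_sub (uτ τ s).fn (u s)]
        with x h2 h3 h4
      rw [h4, Pi.sub_apply] at h2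
      have h5 := norm_add_le ((uτ τ s).fn x - u s x) (u s x)
      rw [sub_add_cancel] at h5
      simp only [hR] at hRp
      linarith
  have hclose := hL2 T ⟨hT.le, le_rfl⟩ hbdd
  intro t ht
  refine ⟨(hclose t ht).trans hAp.le, ?_⟩
  refine (norm_fn_add_sq_le hS hτ0 (half_pos hρ).le hΛ (by positivity) ht.1
    (fun s hs => hB s ⟨hs.1, hs.2.trans ht.2⟩) (fun s hs => hbdd s ⟨hs.1, hs.2.trans ht.2⟩)
    (fun s hs => hmod s t hs.1 hs.2 ht.2)
    (fun s hs => hclose s ⟨hs.1, hs.2.trans ht.2⟩)).trans ?_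
  have := hG t ht
  gcongr

end Limit

/-! ### Passage to the limit -/

section Limit

variable {u₀τ : ℝ → H1 ℂ} {v₀τ : ℝ → H1 ℝ} {u₀ : H1 ℂ}

/-- Either hypothesis on `v₀τ` bounds it in `L²` for small `τ`. With nonpositive energy the
bound comes from the convergence of `u₀τ` in `H¹`. -/
theorem exists_eventually_norm_fn_le (hi : Tendsto (fun τ => ‖u₀τ τ - u₀‖) (𝓝[>] 0) (𝓝 0))
    (h : (∃ C : ℝ, ∀ τ ∈ Ioo (0 : ℝ) 1, ‖(v₀τ τ).fn‖ ≤ C) ∨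
      ∀ τ ∈ Ioo (0 : ℝ) 1, energy (-1) (u₀τ τ) (v₀τ τ) ≤ 0) :
    ∃ V : ℝ, ∀ᶠ τ in 𝓝[>] (0 : ℝ), ‖(v₀τ τ).fn‖ ≤ V := by
  rcases h with ⟨C, hC⟩ | hE
  · refine ⟨C, ?_⟩
    filter_upwards [Ioo_mem_nhdsGT (zero_lt_one (α := ℝ))] with τ hτ using hC τ hτ
  · refine ⟨6 * (‖u₀‖ + 1) ^ 2, ?_⟩
    filter_upwards [Ioo_mem_nhdsGT (zero_lt_one (α := ℝ)), hi.eventually_lt_const one_pos]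
      with τ hτ hu
    refine (norm_fn_le_of_energy_nonpos (hE τ hτ)).trans ?_
    have h1 := norm_add_le (u₀τ τ - u₀) u₀
    rw [sub_add_cancel] at h1
    gcongr
    linarith

end Limit

theorem eLpNorm_sub_eq_enorm (f g : L2 ℂ) : eLpNorm (fun x => f x - g x) 2 volume = ‖f - g‖ₑ := by
  rw [Lp.enorm_def]
  exact eLpNorm_congr_ae (Lp.coeFn_sub f g).symm

theorem eLpNorm_add_sq_eq_enorm (v : L2 ℝ) {f : L2 ℂ} {c : ℝ} (hf : ∀ᵐ x, ‖f x‖ ≤ c) :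
    eLpNorm (fun x => v x + ‖f x‖ ^ 2) 2 volume = ‖v + toL2 fun x => ‖f x‖ ^ 2‖ₑ := by
  rw [Lp.enorm_def]
  refine eLpNorm_congr_ae ?_
  filter_upwards [Lp.coeFn_add v (toL2 fun x => ‖f x‖ ^ 2), coeFn_toL2 (memLp_norm_sq hf)]
    with x h1 h2
  rw [h1, Pi.add_apply, h2]

end SchrodingerDebye

open SchrodingerDebye
theorem theorem1p3
    (u₀τ : ℝ → H1 ℂ) (v₀τ : ℝ → H1 ℝ) (u₀ : H1 ℂ)
    (hi : Tendsto (fun τ => ‖u₀τ τ - u₀‖) (𝓝[>] 0) (𝓝 0))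
    (hii_or_iii :
      (∃ C : ℝ, ∀ τ ∈ Ioo (0 : ℝ) 1, ‖(v₀τ τ).fn‖ ≤ C) ∨
      ((∀ τ ∈ Ioo (0 : ℝ) 1, energy (-1) (u₀τ τ) (v₀τ τ) ≤ 0) ∧
        ∃ γ : ℝ, 0 < γ ∧
          (fun τ => ‖(v₀τ τ).fn‖) =O[𝓝[>] (0 : ℝ)] fun τ => τ ^ (-1 + γ)))
    (uτ : ℝ → ℝ → H1 ℂ) (vτ : ℝ → ℝ → H1 ℝ)
    (hSD : ∀ τ ∈ Ioo (0 : ℝ) 1, IsSDSolution (-1) τ (u₀τ τ) (v₀τ τ) (uτ τ) (vτ τ))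
    (u : ℝ → L2 ℂ) (hNLS : IsNLSSolution (-1) u₀.fn u)
    (T : ℝ) (hT : 0 < T) :
    Tendsto (fun τ => ⨆ t ∈ Icc 0 T, eLpNorm (fun x => (uτ τ t).fn x - u t x) 2 volume)
        (𝓝[>] 0) (𝓝 0) ∧
      Tendsto (fun τ => ∫⁻ t in Icc 0 T,
          eLpNorm (fun x => (vτ τ t).fn x + ‖u t x‖ ^ 2) 2 volume)
        (𝓝[>] 0) (𝓝 0) := by
  obtain ⟨V, hV⟩ := exists_eventually_norm_fn_le hi (hii_or_iii.imp_right And.left)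
  obtain ⟨K, hK, hB, hclose⟩ := eventually_close hi hV hSD hNLS hT
  constructor
  · rw [ENNReal.tendsto_nhds_zero]
    intro ε hε
    obtain ⟨r, hr0, hrε⟩ := ENNReal.lt_iff_exists_nnreal_btwn.mp hε
    have hr : (0 : ℝ) < r := by simpa using hr0
    filter_upwards [hclose r hr] with τ hτ
    refine (iSup₂_le fun t ht => ?_).trans hrε.le
    rw [eLpNorm_sub_eq_enorm, ← ofReal_norm, ENNReal.ofReal_le_iff_le_toReal ENNReal.coe_ne_top]
    exact (hτ t ht).1
  · rw [ENNReal.tendsto_nhds_zero]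
    intro ε hε
    obtain ⟨r, hr0, hrε⟩ := ENNReal.lt_iff_exists_nnreal_btwn.mp hε
    have hr : (0 : ℝ) < r := by simpa using hr0
    have hKτ : ∀ᶠ τ in 𝓝[>] (0 : ℝ), K * τ < r / 2 := by
      refine eventually_nhdsWithin_of_eventually_nhds ?_
      have hc : Continuous fun τ : ℝ => K * τ := by fun_prop
      exact (hc.tendsto 0).eventually_lt_const (by simpa using half_pos hr)
    filter_upwards [hclose (r / (2 * T)) (by positivity), hKτ, self_mem_nhdsWithin]
      with τ hτ hKτ hτ0
    have hint : IntegrableOn (fun t => Real.exp (-t / τ) * K + r / (2 * T)) (Icc 0 T) :=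
      Continuous.integrableOn_Icc (by fun_prop)
    calc ∫⁻ t in Icc 0 T, eLpNorm (fun x => (vτ τ t).fn x + ‖u t x‖ ^ 2) 2 volume
        ≤ ∫⁻ t in Icc 0 T, ENNReal.ofReal (Real.exp (-t / τ) * K + r / (2 * T)) := by
          refine setLIntegral_mono' measurableSet_Icc fun t ht => ?_
          obtain ⟨B, hBt⟩ := hB t ht
          rw [eLpNorm_add_sq_eq_enorm _ hBt, ← ofReal_norm]
          exact ENNReal.ofReal_le_ofReal (hτ t ht).2
      _ = ENNReal.ofReal (∫ t in Icc 0 T, (Real.exp (-t / τ) * K + r / (2 * T))) := by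
          rw [ofReal_integral_eq_lintegral_ofReal hint]
          exact Eventually.of_forall fun t => by
            have : (0 : ℝ) < r / (2 * T) := by positivity
            positivity
      _ ≤ ENNReal.ofReal r := by
          refine ENNReal.ofReal_le_ofReal ?_
          rw [integral_Icc_eq_integral_Ioc, ← intervalIntegral.integral_of_le hT.le,
            intervalIntegral.integral_add (Continuous.intervalIntegrable (by fun_prop) _ _)
              intervalIntegrable_const, intervalIntegral.integral_mul_const,
            intervalIntegral.integral_const]
          have h1 : (∫ t in (0 : ℝ)..T, Real.exp (-t / τ)) * K ≤ τ * K := by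
            gcongr
            exact integral_exp_neg_div_le hτ0 T
          have h2 : (T - 0) • ((r : ℝ) / (2 * T)) = r / 2 := by
            rw [sub_zero, smul_eq_mul]
            field_simp
          rw [h2]
          linarith
      _ ≤ ε := by
          rw [ENNReal.ofReal_coe_nnreal]
          exact hrε.le
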